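/- \textbf{Conventions.} Algebras have non-empty carriers. A \emph{range semigroup} is an algebra $(S;\cdot,{}^*,{}^+)$ where $(S;\cdot)$ is a semigroup and $xx^*=x$, $x^*y^*=y^*x^*=(x^*y^*)^*$, $(xy)^*=(x^*y)^*$, dually $x^+x=x$, $x^+y^+=y^+x^+=(x^+y^+)^+$, $(xy)^+=(xy^+)^+$, and $(x^+)^*=x^+$, $(x^*)^+=x^*$, $x^*y=y(xy)^*$. It is a \emph{birestriction semigroup} if also $xy^+=(xy)^+x$. Morphisms preserve $\cdot,{}^*,{}^+$. An \emph{inverse semigroup} is regarded as a birestriction semigroup via $x^*=x^{-1}x$, $x^+=xx^{-1}$; morphisms are semigroup homomorphisms. The natural partial order is $s\le t\iff s=ts^*$. \textbf{Categories.} A small category is identified with its set $\mathcal C$ of arrows, with domain and range maps $\mathbf d,\mathbf r$ and composition $xy$ defined iff $\mathbf d(x)=\mathbf r(y)$; $\mathcal C^{(0)}\subseteq\mathcal C$ is the set of units (identity arrows). A topological category (with $\mathbf d,\mathbf r$ and composition continuous) is \emph{\'etale} if $\mathcal C^{(0)}$ is locally compact Hausdorff and $\mathbf d\colon\mathcal C\to\mathcal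 C^{(0)}$ is a local homeomorphism. A \emph{slice} is an open set $U\subseteq\mathcal C$ such that $\mathbf d|_U$ is a homeomorphism onto an open subset of $\mathcal C^{(0)}$; it is a \emph{bislice} if $\mathbf r|_U$ has this property too. An \'etale category is \emph{ample} if its compact slices form a basis of the topology, \emph{strongly ample} if moreover $\mathbf r\colon\mathcal C\to\mathcal C^{(0)}$ is open. It is \emph{biample} if $\mathbf r$ is also a local homeomorphism and the compact bislices form a basis. An \emph{ample groupoid} is an ample category all of whose arrows are invertible, with continuous inversion. For $U,V\subseteq\mathcal C$ put $UV=\{xy: x\in U,\ y\in V,\ \mathbf d(x)=\mathbf r(y)\}$, $U^*=\mathbf d(U)$, $U^+=\mathbf r(U)$ and, in a groupoid, $U^{-1}=\{x^{-1}:x\in U\}$. \textbf{Ordered categories.} An \emph{ordered category with restrictions and corestrictions} is a small category $Q$ with a partial order such that: composition is monotone; $s\le t$ implies $\mathbf d(s)\le\mathbf d(t)$ and $\mathbf r(s)\le\mathbf r(t)$; units form a meet-semilattice; for every unit $e\le\mathbf d(s)$ there is a unique $s|_e\le s$ with $\mathbf d(s|_e)=e$; for every unit $e\le\mathbf r(s)$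 there is a greatest element ${}_e|s$ among the $t\le s$ with $\mathbf r(t)\le e$, and $\mathbf r({}_e|s)=e$; and $\mathbf d({}_e|(st))=\mathbf d({}_{\mathbf d({}_e|s)}|t)$ whenever $st$ is defined and $e\le\mathbf r(s)$. Morphisms are order-preserving functors that preserve meets of units, restrictions and corestrictions. An \emph{inductive category} is a small category with a partial order satisfying the first four of these conditions and such that for every unit $e\le\mathbf r(s)$ there is a unique $t\le s$ with $\mathbf r(t)=e$; morphisms are order-preserving functors preserving meets of units. An \emph{inductive groupoid} is an inductive category in which all arrows are invertible and inversion preserves the order; morphisms are those of inductive categories. For a range semigroup $S$, let $\mathscr U(S)$ be the set $S$ with units the projections $s^*$, $\mathbf d(s)=s^*$, $\mathbf r(s)=s^+$, composite $s\cdot t=st$ defined iff $s^*=t^+$, and the natural partial order. It is an ordered category with restrictions $s|_e=se$ and corestrictions ${}_e|s=es$; it is an inductive category if $S$ is birestriction and an inductive groupoid if $S$ is inverse. An \emph{ordered category with restrictions and corestrictions of compact slices} of a strongly ample category $\mathcal C$ is $\mathscr U(S)$, where $S$ is a non-empty set of compact slices of $\mathcal C$ closed under $UV$, $U^*$, $U^+$.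 An \emph{inductive category of compact bislices} of a biample category is $\mathscr U(S)$, where $S$ is a non-empty set of its compact bislices closed under $UV$, $U^*$, $U^+$. An \emph{inductive groupoid of compact bislices} of an ample groupoid is $\mathscr U(S)$, where $S$ is a non-empty set of its compact bislices closed under $UV$ and $U^{-1}$. In each case these objects are taken as a full subcategory of the category of ordered categories with restrictions and corestrictions, of inductive categories, and of inductive groupoids, respectively. \textbf{Theorem.} \begin{enumerate} \item The category of range semigroups is equivalent to the category of ordered categories with restrictions and corestrictions of compact slices of strongly ample categories. \item The category of birestriction semigroups is equivalent to the category of inductive categories of compact bislices of biample categories. \item The category of inverse semigroups is equivalent to the category of inductive groupoids of compact bislices of ample groupoids. \end{enumerate} -/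

import Mathlib

open CategoryTheory

universe u

namespace ESN

/-! ### Semigroups with domain and range operations -/

/-- BiEhresmann semigroups; `st x` is the domain operation `x^*`, `pl x` the range operation `x^+`. -/
class BiEhresmannSemigroup (S : Type u) extends Semigroup S where
  st : S → S
  pl : S → S
  mul_st : ∀ x : S, x * st x = x
  st_comm : ∀ x y : S, st x * st y = st y * st x
  st_mul_st : ∀ x y : S, st (st x * st y) = st x * st y
  st_mul : ∀ x y : S, st (x * y) = st (st x * y)
  pl_mul : ∀ x : S, pl x * x = x
  pl_comm : ∀ x y : S, pl x * pl y = pl y * pl x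
  pl_mul_pl : ∀ x y : S, pl (pl x * pl y) = pl x * pl y
  pl_mul' : ∀ x y : S, pl (x * y) = pl (x * pl y)
  st_pl : ∀ x : S, st (pl x) = pl x
  pl_st : ∀ x : S, pl (st x) = st x

/-- Range semigroups: biEhresmann semigroups satisfying `x^* y = y (x y)^*`. -/
class RangeSemigroup (S : Type u) extends BiEhresmannSemigroup S where
  restr : ∀ x y : S, st x * y = y * st (x * y)

/-- Birestriction semigroups: in addition the dual identity `x y^+ = (x y)^+ x` holds. -/
class BirestrictionSemigroup (S : Type u) extends RangeSemigroup S where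
  corestr : ∀ x y : S, x * pl y = pl (x * y) * x

/-- Inverse semigroups. -/
class InverseSemigroup (S : Type u) extends Semigroup S where
  existsUnique_inverse : ∀ a : S, ∃! b : S, a * b * a = a ∧ b * a * b = b

/-- Objects of the category of range semigroups; algebras have non-empty carriers. -/
structure RangeSgp where
  carrier : Type u
  [nonempty : Nonempty carrier]
  [str : RangeSemigroup carrier]

attribute [instance] RangeSgp.nonempty RangeSgp.str

open BiEhresmannSemigroup in
/-- Maps preserving the multiplication and both unary operations. -/
@[ext]
structure BiHom (S T : Type u) [BiEhresmannSemigroup S] [BiEhresmannSemigroup T] where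
  toFun : S → T
  map_mul : ∀ x y, toFun (x * y) = toFun x * toFun y
  map_st : ∀ x, toFun (st x) = st (toFun x)
  map_pl : ∀ x, toFun (pl x) = pl (toFun x)

/-- The identity morphism. -/
def BiHom.id (S : Type u) [BiEhresmannSemigroup S] : BiHom S S :=
  ⟨fun x => x, fun _ _ => rfl, fun _ => rfl, fun _ => rfl⟩

/-- Composition of morphisms: first `f`, then `g`. -/
def BiHom.comp {S T R : Type u} [BiEhresmannSemigroup S] [BiEhresmannSemigroup T]
    [BiEhresmannSemigroup R] (f : BiHom S T) (g : BiHom T R) : BiHom S R :=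
  ⟨fun x => g.toFun (f.toFun x), fun x y => by rw [f.map_mul, g.map_mul],
    fun x => by rw [f.map_st, g.map_st], fun x => by rw [f.map_pl, g.map_pl]⟩

instance : Category.{u} RangeSgp.{u} where
  Hom S T := BiHom S.carrier T.carrier
  id S := BiHom.id S.carrier
  comp f g := BiHom.comp f g

/-- Objects of the category of birestriction semigroups. -/
structure BirestrictionSgp where
  carrier : Type u
  [nonempty : Nonempty carrier]
  [str : BirestrictionSemigroup carrier]

attribute [instance] BirestrictionSgp.nonempty BirestrictionSgp.str

instance : Category.{u} BirestrictionSgp.{u} where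
  Hom S T := BiHom S.carrier T.carrier
  id S := BiHom.id S.carrier
  comp f g := BiHom.comp f g

/-- Objects of the category of inverse semigroups and semigroup homomorphisms. -/
structure InverseSgp where
  carrier : Type u
  [nonempty : Nonempty carrier]
  [str : InverseSemigroup carrier]

attribute [instance] InverseSgp.nonempty InverseSgp.str

instance : Category.{u} InverseSgp.{u} where
  Hom S T := S.carrier →ₙ* T.carrier
  id S := MulHom.id S.carrier
  comp f g := MulHom.comp g f

/-! ### Small categories as partial algebras of arrows -/

/-- A small category given by its set of arrows; objects are identified with identity arrows.
The product `x y` is defined when `dom x = ran y`. -/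
class SmallCat (C : Type u) where
  dom : C → C
  ran : C → C
  comp : ∀ x y : C, dom x = ran y → C
  range_dom : Set.range dom = Set.range ran
  dom_unit : ∀ x ∈ Set.range dom, dom x = x
  ran_unit : ∀ x ∈ Set.range dom, ran x = x
  dom_comp : ∀ (x y : C) (h : dom x = ran y), dom (comp x y h) = dom y
  ran_comp : ∀ (x y : C) (h : dom x = ran y), ran (comp x y h) = ran x
  assoc : ∀ (x y z : C) (h : dom x = ran y) (k : dom y = ran z),
    comp (comp x y h) z ((dom_comp x y h).trans k) =
      comp x (comp y z k) (h.trans (ran_comp y z k).symm)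
  ran_mul : ∀ (x : C) (h : dom (ran x) = ran x), comp (ran x) x h = x
  mul_dom : ∀ (x : C) (h : dom x = ran (dom x)), comp x (dom x) h = x

open SmallCat

/-- The set of units. -/
def units (C : Type u) [SmallCat C] : Set C := Set.range dom

section basic

variable {C : Type u} [SmallCat C]

theorem dom_mem_units (x : C) : dom x ∈ units C := ⟨x, rfl⟩

theorem ran_mem_units (x : C) : ran x ∈ units C := by
  rw [units, range_dom]; exact ⟨x, rfl⟩

theorem dom_dom (x : C) : dom (dom x) = dom x := dom_unit _ (dom_mem_units x)
theorem ran_dom (x : C) : ran (dom x) = dom x := ran_unit _ (dom_mem_units x)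
theorem dom_ran (x : C) : dom (ran x) = ran x := dom_unit _ (ran_mem_units x)
theorem ran_ran (x : C) : ran (ran x) = ran x := ran_unit _ (ran_mem_units x)

/-- `y` is an inverse of the arrow `x`. -/
def IsInverseArrow (x y : C) : Prop :=
  ∃ (h : dom x = ran y) (k : dom y = ran x), comp x y h = ran x ∧ comp y x k = dom x

/-- The product `UV` of sets of arrows. -/
def setMul (U V : Set C) : Set C :=
  {z | ∃ x ∈ U, ∃ y ∈ V, ∃ h : dom x = ran y, comp x y h = z}

/-- `U^*`, the set of domains. -/
def setDom (U : Set C) : Set C := dom '' U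

/-- `U^+`, the set of ranges. -/
def setRan (U : Set C) : Set C := ran '' U

/-- The set of inverses of the elements of `U`. -/
def setInv (U : Set C) : Set C := {y | ∃ x ∈ U, IsInverseArrow x y}

theorem comp_ran_left (e x : C) (he : e ∈ units C) (h : dom e = ran x) : comp e x h = x := by
  have h1 : e = ran x := by rw [← h, dom_unit e he]
  subst h1; exact ran_mul x h

theorem comp_dom_right (x e : C) (he : e ∈ units C) (h : dom x = ran e) : comp x e h = x := by
  have h1 : e = dom x := by rw [h, ran_unit e he]
  subst h1; exact mul_dom x h

theorem comp_congr {x x' y y' : C} (hx : x = x') (hy : y = y') (h : dom x = ran y)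
    (h' : dom x' = ran y') : comp x y h = comp x' y' h' := by
  subst hx hy; rfl

end basic

/-! ### Topological, etale and ample categories -/

section topology

variable (C : Type u) [SmallCat C] [TopologicalSpace C]

/-- The domain map as a map to the space of units. -/
def domU (x : C) : units C := ⟨dom x, dom_mem_units x⟩

/-- The range map as a map to the space of units. -/
def ranU (x : C) : units C := ⟨ran x, ran_mem_units x⟩

/-- Topological categories. -/
structure IsTopologicalCat : Prop where
  continuous_dom : Continuous (domU C)
  continuous_ran : Continuous (ranU C)
  continuous_comp : Continuous
    (fun p : {p : C × C // dom p.1 = ran p.2} => comp p.1.1 p.1.2 p.2)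

/-- Etale categories. -/
structure IsEtale : Prop extends IsTopologicalCat C where
  locallyCompact : LocallyCompactSpace (units C)
  hausdorff : T2Space (units C)
  localHomeo_dom : IsLocalHomeomorph (domU C)

variable {C} in
/-- Slices: open sets on which `dom` is a homeomorphism onto an open set of units. -/
def IsSlice (U : Set C) : Prop :=
  IsOpen U ∧ Topology.IsOpenEmbedding (fun x : U => domU C x)

variable {C} in
/-- Coslices: open sets on which `ran` is a homeomorphism onto an open set of units. -/
def IsCoslice (U : Set C) : Prop :=
  IsOpen U ∧ Topology.IsOpenEmbedding (fun x : U => ranU C x)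

variable {C} in
/-- Bislices. -/
def IsBislice (U : Set C) : Prop := IsSlice U ∧ IsCoslice U

/-- Ample categories. -/
structure IsAmple : Prop extends IsEtale C where
  basis : TopologicalSpace.IsTopologicalBasis {U : Set C | IsSlice U ∧ IsCompact U}

/-- Strongly ample categories: ample categories with open range map. -/
structure IsStronglyAmple : Prop extends IsAmple C where
  isOpenMap_ran : IsOpenMap (ranU C)

/-- Biample categories: both `dom` and `ran` are local homeomorphisms and the compact bislices
form a basis of the topology. -/
structure IsBiample : Prop extends IsEtale C where
  localHomeo_ran : IsLocalHomeomorph (ranU C)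
  basis : TopologicalSpace.IsTopologicalBasis {U : Set C | IsBislice U ∧ IsCompact U}

/-- Ample groupoids: ample categories in which every arrow is invertible, the inversion being
continuous. -/
structure IsAmpleGroupoid : Prop extends IsAmple C where
  inversion : ∃ inv : C → C, Continuous inv ∧ ∀ x, IsInverseArrow x (inv x)

end topology

/-! ### Ordered categories -/

/-- A small category with a compatible partial order and unique restrictions `s|_e`, `e ≤ dom s`,
whose units form a meet-semilattice. -/
class OrderedCat (C : Type u) extends SmallCat C, PartialOrder C where
  comp_le_comp : ∀ (s t u v : C) (h : dom s = ran u) (k : dom t = ran v), s ≤ t → u ≤ v →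
    comp s u h ≤ comp t v k
  dom_mono : ∀ s t : C, s ≤ t → dom s ≤ dom t
  ran_mono : ∀ s t : C, s ≤ t → ran s ≤ ran t
  restriction : ∀ e ∈ units C, ∀ s : C, e ≤ dom s → ∃! t : C, t ≤ s ∧ dom t = e
  meet : ∀ e ∈ units C, ∀ f ∈ units C, ∃ g ∈ units C, g ≤ e ∧ g ≤ f ∧
    ∀ h ∈ units C, h ≤ e → h ≤ f → h ≤ g

section ordered

variable {C : Type u} [OrderedCat C]

/-- `g` is the meet of the units `e` and `f` in the poset of units. -/
def IsMeet (e f g : C) : Prop :=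
  g ∈ units C ∧ g ≤ e ∧ g ≤ f ∧ ∀ h ∈ units C, h ≤ e → h ≤ f → h ≤ g

/-- `t` is the corestriction of `s` to the unit `e`: the greatest element below `s` whose range
is below `e`. -/
def IsCorestriction (e s t : C) : Prop := IsGreatest {t : C | t ≤ s ∧ ran t ≤ e} t

theorem eq_dom_of_le_unit {w e : C} (he : e ∈ units C) (h : w ≤ e) : w = dom w := by
  have h1 : dom w ≤ e := by
    have := OrderedCat.dom_mono w e h
    rwa [dom_unit e he] at this
  have h2 : dom w ≤ dom e := by rwa [dom_unit e he]
  exact (OrderedCat.restriction (dom w) (dom_mem_units w) e h2).unique ⟨h, rfl⟩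
    ⟨h1, dom_dom w⟩

theorem IsInverseArrow.le_of_le {x y x' y' : C} (hx : IsInverseArrow x x')
    (hy : IsInverseArrow y y') (h : x ≤ y) : x' ≤ y' := by
  obtain ⟨x1, x2, x3, x4⟩ := hx
  obtain ⟨y1, y2, y3, y4⟩ := hy
  have h1 : dom x' ≤ dom y' := by rw [x2, y2]; exact OrderedCat.ran_mono x y h
  obtain ⟨z, ⟨hz, hzd⟩, _⟩ := OrderedCat.restriction (dom x') (dom_mem_units x') y' h1
  have k : dom z = ran x := hzd.trans x2
  have h2 : comp z x k ≤ dom y := by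
    rw [← y4]; exact OrderedCat.comp_le_comp z y' x y k y2 hz h
  have h3 : comp z x k = dom x := by
    rw [eq_dom_of_le_unit (dom_mem_units y) h2, dom_comp]
  have h4 : z = x' := by
    have e1 : comp z (comp x x' x1) (by rw [ran_comp, k]) = z := by
      rw [comp_congr rfl x3 _ (by rw [ran_ran, k])]
      exact comp_dom_right _ _ (ran_mem_units x) _
    have e2 : comp (comp z x k) x' (by rw [dom_comp, x1]) = x' := by
      rw [comp_congr h3 rfl _ (by rw [dom_dom, x1])]
      exact comp_ran_left _ _ (dom_mem_units x) _
    rw [← e1, ← assoc z x x' k x1, e2]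
  rw [← h4]; exact hz

end ordered

/-- Ordered categories with restrictions and corestrictions. -/
class OrderedCatRC (C : Type u) extends OrderedCat C where
  corestriction : ∀ e ∈ units C, ∀ s : C, e ≤ ran s → ∃ t : C, IsCorestriction e s t ∧ ran t = e
  dom_corestriction : ∀ e ∈ units C, ∀ (s t : C) (h : dom s = ran t), e ≤ ran s →
    ∀ s' t' w : C, IsCorestriction e s s' → IsCorestriction (dom s') t t' →
      IsCorestriction e (comp s t h) w → dom w = dom t'

/-- Inductive categories. -/
class InductiveCat (C : Type u) extends OrderedCat C where
  corestriction : ∀ e ∈ units C, ∀ s : C, e ≤ ran s → ∃! t : C, t ≤ s ∧ ran t = e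

/-- Inductive functors: order preserving functors which preserve meets of units.
(Unique restrictions, and unique corestrictions if there are any, are then preserved as well.) -/
@[ext]
structure IndFunctor (C D : Type u) [OrderedCat C] [OrderedCat D] where
  toFun : C → D
  map_dom : ∀ x, toFun (dom x) = dom (toFun x)
  map_ran : ∀ x, toFun (ran x) = ran (toFun x)
  map_comp : ∀ (x y : C) (h : dom x = ran y),
    toFun (comp x y h) = comp (toFun x) (toFun y) (by rw [← map_dom, h, map_ran])
  monotone : ∀ x y : C, x ≤ y → toFun x ≤ toFun y
  map_meet : ∀ e ∈ units C, ∀ f ∈ units C, ∀ g : C, IsMeet e f g →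
    IsMeet (toFun e) (toFun f) (toFun g)

/-- The identity functor. -/
def IndFunctor.id (C : Type u) [OrderedCat C] : IndFunctor C C :=
  ⟨fun x => x, fun _ => rfl, fun _ => rfl, fun _ _ _ => rfl, fun _ _ h => h,
    fun _ _ _ _ _ h => h⟩

theorem IndFunctor.map_unit {C D : Type u} [OrderedCat C] [OrderedCat D] (F : IndFunctor C D)
    {e : C} (he : e ∈ units C) : F.toFun e ∈ units D := by
  obtain ⟨x, rfl⟩ := he
  rw [F.map_dom]; exact dom_mem_units _

/-- Composition of functors: first `F`, then `G`. -/
def IndFunctor.comp {C D E : Type u} [OrderedCat C] [OrderedCat D] [OrderedCat E]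
    (F : IndFunctor C D) (G : IndFunctor D E) : IndFunctor C E where
  toFun x := G.toFun (F.toFun x)
  map_dom x := by rw [F.map_dom, G.map_dom]
  map_ran x := by rw [F.map_ran, G.map_ran]
  map_comp x y h := by simp only [F.map_comp x y h, G.map_comp]
  monotone x y h := G.monotone _ _ (F.monotone _ _ h)
  map_meet e he f hf g h := G.map_meet _ (F.map_unit he) _ (F.map_unit hf) _
    (F.map_meet e he f hf g h)

/-- Morphisms of ordered categories with restrictions and corestrictions. -/
@[ext]
structure RCFunctor (C D : Type u) [OrderedCat C] [OrderedCat D] extends IndFunctor C D where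
  map_corestriction : ∀ e ∈ units C, ∀ s t : C, e ≤ ran s → IsCorestriction e s t →
    IsCorestriction (toFun e) (toFun s) (toFun t)

/-- The identity morphism. -/
def RCFunctor.id (C : Type u) [OrderedCat C] : RCFunctor C C :=
  ⟨IndFunctor.id C, fun _ _ _ _ _ h => h⟩

/-- Composition of morphisms: first `F`, then `G`. -/
def RCFunctor.comp {C D E : Type u} [OrderedCat C] [OrderedCat D] [OrderedCat E]
    (F : RCFunctor C D) (G : RCFunctor D E) : RCFunctor C E where
  toIndFunctor := F.toIndFunctor.comp G.toIndFunctor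
  map_corestriction e he s t hs h :=
    G.map_corestriction _ (F.map_unit he) _ _
      (by have := F.monotone _ _ hs; rwa [F.map_ran] at this)
      (F.map_corestriction e he s t hs h)

/-- Objects of the category of ordered categories with restrictions and corestrictions. -/
structure OrdCatRC where
  carrier : Type u
  [str : OrderedCatRC carrier]

attribute [instance] OrdCatRC.str

instance : Category.{u} OrdCatRC.{u} where
  Hom C D := RCFunctor C.carrier D.carrier
  id C := RCFunctor.id C.carrier
  comp F G := RCFunctor.comp F G

/-- Objects of the category of inductive categories. -/
structure IndCat where
  carrier : Type u
  [str : InductiveCat carrier]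

attribute [instance] IndCat.str

instance : Category.{u} IndCat.{u} where
  Hom C D := IndFunctor C.carrier D.carrier
  id C := IndFunctor.id C.carrier
  comp F G := IndFunctor.comp F G

/-- Inductive groupoids: inductive categories in which all arrows are invertible and inversion
preserves the order. -/
def isInductiveGroupoid : ObjectProperty IndCat.{u} := fun G =>
  (∀ x : G.carrier, ∃ y, IsInverseArrow x y) ∧
    ∀ x y x' y' : G.carrier, IsInverseArrow x x' → IsInverseArrow y y' → x ≤ y → x' ≤ y'

/-- The category of inductive groupoids and inductive functors. -/
abbrev IndGpd : Type (u + 1) := isInductiveGroupoid.{u}.FullSubcategory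

/-! ### The ordered category of a range semigroup -/

/-- The set `S` regarded as the underlying ordered category of the range semigroup `S`. -/
structure Underlying (S : Type u) where
  val : S

section underlying

open BiEhresmannSemigroup

variable {S : Type u}

section biEhresmann

variable [BiEhresmannSemigroup S]

theorem st_idem (x : S) : st x * st x = st x := by
  have h := mul_st (st x)
  have h2 : st (st x) = st x := by
    have h3 := st_mul x (st x)
    rw [mul_st, st_mul_st] at h3
    have h4 : st x * st (st x) = st x := mul_st (st x)
    have h5 : st (st x * st x) = st x := by rw [st_mul_st, ← h3]
    rw [← h3] at h5
    exact h5
  rwa [h2] at h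

theorem st_st (x : S) : st (st x) = st x := by
  have h := st_mul_st x x
  rwa [st_idem] at h

theorem pl_pl (x : S) : pl (pl x) = pl x := by
  rw [← st_pl x, pl_st]

theorem pl_idem (x : S) : pl x * pl x = pl x := by
  have h := st_idem (pl x)
  rwa [st_pl] at h

theorem st_mul_pl (x y : S) : st x * pl y = pl y * st x := by
  rw [← st_pl y, st_comm]

end biEhresmann

variable [RangeSemigroup S]

/-- The underlying category: `dom s = s^*`, `ran s = s^+`, and the product `s t` is defined when
`s^* = t^+`. -/
instance : SmallCat (Underlying S) where
  dom s := ⟨st s.val⟩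
  ran s := ⟨pl s.val⟩
  comp s t _ := ⟨s.val * t.val⟩
  range_dom := by
    ext x; constructor
    · rintro ⟨y, rfl⟩; exact ⟨⟨st y.val⟩, by simp [pl_st]⟩
    · rintro ⟨y, rfl⟩; exact ⟨⟨pl y.val⟩, by simp [st_pl]⟩
  dom_unit := by rintro _ ⟨y, rfl⟩; simp [st_st]
  ran_unit := by rintro _ ⟨y, rfl⟩; simp [pl_st]
  dom_comp x y h := by
    simp only [Underlying.mk.injEq] at h ⊢
    rw [st_mul, h, pl_mul]
  ran_comp x y h := by
    simp only [Underlying.mk.injEq] at h ⊢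
    rw [pl_mul', ← h, mul_st]
  assoc x y z _ _ := by simp [mul_assoc]
  ran_mul x _ := by simp [pl_mul]
  mul_dom x _ := by simp [mul_st]

theorem mem_units_underlying {e : Underlying S} (h : e ∈ units (Underlying S)) :
    st e.val = e.val := by
  obtain ⟨x, rfl⟩ := h; exact st_st _

theorem natural_st {s t : S} (h : s = t * st s) : st s = st t * st s := by
  have h2 : st (t * st s) = st t * st s := by rw [st_mul, st_mul_st]
  rwa [← h] at h2

theorem natural_pl {s t : S} (h : s = t * st s) : pl s = pl t * pl s := by
  have h1 : pl t * s = s := by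
    conv_lhs => rw [h, ← mul_assoc, pl_mul, ← h]
  have h2 := pl_mul' (pl t) s
  rwa [h1, pl_mul_pl] at h2

/-- The natural partial order `s ≤ t ↔ s = t s^*`. -/
instance : PartialOrder (Underlying S) where
  le s t := s.val = t.val * st s.val
  le_refl s := (mul_st _).symm
  le_trans s t u h k := by
    have h1 := natural_st h
    calc s.val = t.val * st s.val := h
      _ = u.val * st t.val * st s.val := by rw [← k]
      _ = u.val * st s.val := by rw [mul_assoc, ← h1]
  le_antisymm s t h k := by
    have h1 := natural_st h
    have h2 := natural_st k
    have h3 : st s.val = st t.val := by rw [h1, st_comm, ← h2]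
    cases s; cases t
    simp only [Underlying.mk.injEq] at *
    rw [h, h3, mul_st]

theorem underlying_le_iff {s t : Underlying S} : s ≤ t ↔ s.val = t.val * st s.val := Iff.rfl

theorem unit_le_iff {e f : Underlying S} (he : st e.val = e.val) :
    e ≤ f ↔ e.val = f.val * e.val := by
  rw [underlying_le_iff, he]

theorem natural_mul {s t u v : S} (h : s = t * st s) (k : u = v * st u) :
    s * u = t * v * st (s * u) := by
  have h2 : s * u = t * (st s * v) * st u := by
    conv_lhs => rw [h, k]
    simp only [mul_assoc]
  have h3 : s * u = t * v * (st (s * v) * st u) := by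
    rw [h2, RangeSemigroup.restr]; simp only [mul_assoc]
  have h4 : st (s * u) = st (s * v) * st u := by
    conv_lhs => rw [k, ← mul_assoc, st_mul, st_mul_st]
  rw [h4]; exact h3

theorem le_corestr {s t e : S} (h : t = s * st t) (he : st e = e) (hr : pl t = e * pl t) :
    t = e * s * st t := by
  have h1 : e * t = t := by
    conv_rhs => rw [← pl_mul t, hr, mul_assoc, pl_mul]
  rw [mul_assoc, ← h, h1]

theorem proj_mul_le {s e : S} (he : st e = e) : e * s = s * st (e * s) := by
  have := RangeSemigroup.restr e s
  rwa [he] at this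

theorem proj_pl {e : S} (he : st e = e) : pl e = e := by
  have h := pl_st e
  rwa [he] at h

theorem pl_proj_mul {e s : S} (he : st e = e) : pl (e * s) = e * pl s := by
  have h := pl_mul_pl e s
  rw [proj_pl he] at h
  rw [pl_mul', h]

instance : OrderedCat (Underlying S) where
  comp_le_comp s t u v _ _ h k := natural_mul h k
  dom_mono s t h := by
    change st s.val = st t.val * st (st s.val)
    rw [st_st]; exact natural_st h
  ran_mono s t h := by
    change pl s.val = pl t.val * st (pl s.val)
    rw [st_pl]; exact natural_pl h
  restriction e he s h := by
    have he' := mem_units_underlying he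
    have h1 : e.val = st s.val * e.val := (unit_le_iff he').1 h
    have h2 : st (s.val * e.val) = e.val := by rw [st_mul, ← h1, he']
    refine ⟨⟨s.val * e.val⟩, ⟨?_, ?_⟩, ?_⟩
    · change s.val * e.val = s.val * st (s.val * e.val)
      rw [h2]
    · change Underlying.mk (st (s.val * e.val)) = e
      rw [h2]
    · rintro ⟨t⟩ ⟨ht, hd⟩
      have ht' : t = s.val * st t := ht
      have hd' : st t = e.val := congrArg Underlying.val hd
      rw [Underlying.mk.injEq, ← hd']; exact ht'
  meet e he f hf := by
    have he' := mem_units_underlying he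
    have hf' := mem_units_underlying hf
    have hc : e.val * f.val = f.val * e.val := by rw [← he', ← hf', st_comm]
    have hef : st (e.val * f.val) = e.val * f.val := by
      have := st_mul_st e.val f.val
      rwa [he', hf'] at this
    have hee : e.val * e.val = e.val := by have := st_idem e.val; rwa [he'] at this
    have hff : f.val * f.val = f.val := by have := st_idem f.val; rwa [hf'] at this
    refine ⟨⟨e.val * f.val⟩, ⟨⟨e.val * f.val⟩, congrArg Underlying.mk hef⟩, ?_, ?_, ?_⟩
    · rw [unit_le_iff hef]; change e.val * f.val = _
      rw [← mul_assoc, hee]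
    · rw [unit_le_iff hef]; change e.val * f.val = _
      rw [hc, ← mul_assoc, hff]
    · intro h hh h1 h2
      have hh' := mem_units_underlying hh
      rw [unit_le_iff hh'] at h1 h2 ⊢
      change h.val = e.val * f.val * h.val
      rw [mul_assoc, ← h2, ← h1]

theorem isCorestriction_iff {e s t : Underlying S} (he : e ∈ units (Underlying S)) :
    IsCorestriction e s t ↔ t.val = e.val * s.val := by
  have he' := mem_units_underlying he
  have hee : e.val * e.val = e.val := by have := st_idem e.val; rwa [he'] at this
  have key : IsCorestriction e s ⟨e.val * s.val⟩ := by
    refine ⟨⟨proj_mul_le he', ?_⟩, ?_⟩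
    · change pl (e.val * s.val) = e.val * st (pl (e.val * s.val))
      rw [st_pl, pl_proj_mul he', ← mul_assoc, hee]
    · rintro r ⟨h1, h2⟩
      have h3 : pl r.val = e.val * st (pl r.val) := h2
      rw [st_pl] at h3
      exact le_corestr h1 he' h3
  constructor
  · intro h
    have := h.unique key
    rw [this]
  · intro h
    have : t = ⟨e.val * s.val⟩ := by cases t; simpa using h
    rw [this]; exact key

/-- The underlying ordered category of a range semigroup, with corestrictions `e|s = e s`. -/
instance : OrderedCatRC (Underlying S) where
  corestriction e he s h := by
    have he' := mem_units_underlying he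
    refine ⟨⟨e.val * s.val⟩, (isCorestriction_iff he).2 rfl, ?_⟩
    have h1 : e.val = pl s.val * e.val := (unit_le_iff he').1 h
    have h2 : e.val * pl s.val = pl s.val * e.val := by rw [← he', st_mul_pl]
    change Underlying.mk (pl (e.val * s.val)) = e
    rw [pl_proj_mul he', h2, ← h1]
  dom_corestriction e he s t _ _ s' t' w h1 h2 h3 := by
    rw [isCorestriction_iff he] at h1 h3
    rw [isCorestriction_iff (dom_mem_units _)] at h2
    change Underlying.mk (st w.val) = Underlying.mk (st t'.val)
    rw [h2, h3]
    change Underlying.mk (st (e.val * (s.val * t.val))) = Underlying.mk (st (st s'.val * t.val))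
    rw [h1, ← mul_assoc, st_mul]

end underlying

section underlyingInductive

open BiEhresmannSemigroup

/-- The underlying category of a birestriction semigroup is inductive. -/
instance {S : Type u} [BirestrictionSemigroup S] : InductiveCat (Underlying S) where
  corestriction e he s h := by
    have he' := mem_units_underlying he
    obtain ⟨t, ht, hr⟩ := OrderedCatRC.corestriction e he s h
    refine ⟨t, ⟨ht.1.1, hr⟩, ?_⟩
    rintro r ⟨hrs, hre⟩
    have h1 : r.val = s.val * st r.val := hrs
    have h2 : pl r.val = e.val := congrArg Underlying.val hre
    have h3 : t.val = e.val * s.val := (isCorestriction_iff he).1 ht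
    have h4 : r.val = pl (s.val * st r.val) * s.val := by
      have := BirestrictionSemigroup.corestr s.val (st r.val)
      rw [pl_st, ← h1] at this
      rw [← h1]; exact this
    rw [← h1, h2, ← h3] at h4
    cases r; cases t; exact congrArg Underlying.mk h4

end underlyingInductive

/-! ### Algebras of compact slices -/

section slices

variable (C : Type u) [SmallCat C] [TopologicalSpace C]

/-- Non-empty sets of compact slices closed under the operations `UV`, `U^*`, `U^+`. -/
structure SliceAlgebra where
  carrier : Set (Set C)
  nonempty : carrier.Nonempty
  isSlice : ∀ U ∈ carrier, IsSlice U
  isCompact : ∀ U ∈ carrier, IsCompact U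
  mul_mem : ∀ U ∈ carrier, ∀ V ∈ carrier, setMul U V ∈ carrier
  dom_mem : ∀ U ∈ carrier, setDom U ∈ carrier
  ran_mem : ∀ U ∈ carrier, setRan U ∈ carrier

/-- Non-empty sets of compact bislices closed under the operations `UV`, `U^*`, `U^+`. -/
structure BisliceAlgebra extends SliceAlgebra C where
  isBislice : ∀ U ∈ carrier, IsBislice U

/-- Non-empty sets of compact bislices closed under `UV` and under inversion, of a groupoid.
(They are closed under `U^* = U⁻¹ U` and `U^+ = U U⁻¹`.) -/
structure InverseBisliceAlgebra where
  carrier : Set (Set C)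
  nonempty : carrier.Nonempty
  isBislice : ∀ U ∈ carrier, IsBislice U
  isCompact : ∀ U ∈ carrier, IsCompact U
  mul_mem : ∀ U ∈ carrier, ∀ V ∈ carrier, setMul U V ∈ carrier
  inv_mem : ∀ U ∈ carrier, setInv U ∈ carrier

variable {C}

theorem IsSlice.injOn {U : Set C} (h : IsSlice U) {x y : C} (hx : x ∈ U) (hy : y ∈ U)
    (hxy : dom x = dom y) : x = y :=
  congrArg Subtype.val (h.2.injective (a₁ := ⟨x, hx⟩) (a₂ := ⟨y, hy⟩) (Subtype.ext hxy))

theorem IsCoslice.injOn {U : Set C} (h : IsCoslice U) {x y : C} (hx : x ∈ U) (hy : y ∈ U)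
    (hxy : ran x = ran y) : x = y :=
  congrArg Subtype.val (h.2.injective (a₁ := ⟨x, hx⟩) (a₂ := ⟨y, hy⟩) (Subtype.ext hxy))

section algebra

variable {C : Type u} [SmallCat C]

theorem setMul_assoc (U V W : Set C) : setMul (setMul U V) W = setMul U (setMul V W) := by
  ext w; constructor
  · rintro ⟨_, ⟨x, hx, y, hy, h, rfl⟩, z, hz, k, rfl⟩
    have k' : dom y = ran z := by rwa [dom_comp] at k
    exact ⟨x, hx, comp y z k', ⟨y, hy, z, hz, k', rfl⟩, h.trans (ran_comp y z k').symm,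
      (assoc x y z h k').symm⟩
  · rintro ⟨x, hx, _, ⟨y, hy, z, hz, k, rfl⟩, h, rfl⟩
    have h' : dom x = ran y := by rwa [ran_comp] at h
    exact ⟨comp x y h', ⟨x, hx, y, hy, h', rfl⟩, z, hz, (dom_comp x y h').trans k,
      assoc x y z h' k⟩

theorem setDom_subset (U : Set C) : setDom U ⊆ units C := by
  rintro _ ⟨x, _, rfl⟩; exact dom_mem_units x

theorem setRan_subset (U : Set C) : setRan U ⊆ units C := by
  rintro _ ⟨x, _, rfl⟩; exact ran_mem_units x

theorem mem_unit_mul {E U : Set C} (hE : E ⊆ units C) {z : C} :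
    z ∈ setMul E U ↔ z ∈ U ∧ ran z ∈ E := by
  constructor
  · rintro ⟨e, he, y, hy, h, rfl⟩
    rw [comp_ran_left e y (hE he) h, ← h, dom_unit e (hE he)]
    exact ⟨hy, he⟩
  · rintro ⟨hz, hE'⟩
    exact ⟨ran z, hE', z, hz, dom_ran z, ran_mul z _⟩

theorem mem_mul_unit {E U : Set C} (hE : E ⊆ units C) {z : C} :
    z ∈ setMul U E ↔ z ∈ U ∧ dom z ∈ E := by
  constructor
  · rintro ⟨y, hy, e, he, h, rfl⟩
    rw [comp_dom_right y e (hE he) h, h, ran_unit e (hE he)]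
    exact ⟨hy, he⟩
  · rintro ⟨hz, hE'⟩
    exact ⟨z, hz, dom z, hE', (ran_dom z).symm, mul_dom z _⟩

theorem unit_mul_unit {E F : Set C} (hE : E ⊆ units C) (hF : F ⊆ units C) :
    setMul E F = E ∩ F := by
  ext z
  rw [mem_unit_mul hE]
  constructor
  · rintro ⟨h1, h2⟩; rw [ran_unit z (hF h1)] at h2; exact ⟨h2, h1⟩
  · rintro ⟨h1, h2⟩; refine ⟨h2, ?_⟩; rwa [ran_unit z (hF h2)]

theorem setDom_unit {E : Set C} (hE : E ⊆ units C) : setDom E = E := by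
  ext z; constructor
  · rintro ⟨x, hx, rfl⟩; rwa [dom_unit x (hE hx)]
  · intro hz; exact ⟨z, hz, dom_unit z (hE hz)⟩

theorem setRan_unit {E : Set C} (hE : E ⊆ units C) : setRan E = E := by
  ext z; constructor
  · rintro ⟨x, hx, rfl⟩; rwa [ran_unit x (hE hx)]
  · intro hz; exact ⟨z, hz, ran_unit z (hE hz)⟩

theorem mem_setDom_mul {U V : Set C} {e : C} :
    e ∈ setDom (setMul U V) ↔ ∃ y ∈ V, ran y ∈ setDom U ∧ dom y = e := by
  constructor
  · rintro ⟨_, ⟨x, hx, y, hy, h, rfl⟩, rfl⟩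
    exact ⟨y, hy, ⟨x, hx, h⟩, (dom_comp x y h).symm⟩
  · rintro ⟨y, hy, ⟨x, hx, h⟩, rfl⟩
    exact ⟨_, ⟨x, hx, y, hy, h, rfl⟩, dom_comp x y h⟩

theorem mem_setRan_mul {U V : Set C} {e : C} :
    e ∈ setRan (setMul U V) ↔ ∃ x ∈ U, dom x ∈ setRan V ∧ ran x = e := by
  constructor
  · rintro ⟨_, ⟨x, hx, y, hy, h, rfl⟩, rfl⟩
    exact ⟨x, hx, ⟨y, hy, h.symm⟩, (ran_comp x y h).symm⟩
  · rintro ⟨x, hx, ⟨y, hy, h⟩, rfl⟩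
    exact ⟨_, ⟨x, hx, y, hy, h.symm, rfl⟩, ran_comp x y h.symm⟩

end algebra

/-- An algebra of compact slices is a range semigroup with respect to `UV`, `U^*`, `U^+`. -/
instance (A : SliceAlgebra C) : RangeSemigroup A.carrier where
  mul U V := ⟨setMul U.1 V.1, A.mul_mem _ U.2 _ V.2⟩
  st U := ⟨setDom U.1, A.dom_mem _ U.2⟩
  pl U := ⟨setRan U.1, A.ran_mem _ U.2⟩
  mul_assoc U V W := Subtype.ext (setMul_assoc U.1 V.1 W.1)
  mul_st U := Subtype.ext <| by
    change setMul U.1 (setDom U.1) = U.1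
    ext z; rw [mem_mul_unit (setDom_subset _)]
    exact ⟨fun h => h.1, fun h => ⟨h, z, h, rfl⟩⟩
  st_comm U V := Subtype.ext <| by
    change setMul (setDom U.1) (setDom V.1) = setMul (setDom V.1) (setDom U.1)
    rw [unit_mul_unit (setDom_subset _) (setDom_subset _),
      unit_mul_unit (setDom_subset _) (setDom_subset _), Set.inter_comm]
  st_mul_st U V := Subtype.ext <| by
    change setDom (setMul (setDom U.1) (setDom V.1)) = setMul (setDom U.1) (setDom V.1)
    rw [unit_mul_unit (setDom_subset _) (setDom_subset _)]
    exact setDom_unit (Set.inter_subset_left.trans (setDom_subset _))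
  st_mul U V := Subtype.ext <| by
    change setDom (setMul U.1 V.1) = setDom (setMul (setDom U.1) V.1)
    ext z; rw [mem_setDom_mul, mem_setDom_mul, setDom_unit (setDom_subset _)]
  pl_mul U := Subtype.ext <| by
    change setMul (setRan U.1) U.1 = U.1
    ext z; rw [mem_unit_mul (setRan_subset _)]
    exact ⟨fun h => h.1, fun h => ⟨h, z, h, rfl⟩⟩
  pl_comm U V := Subtype.ext <| by
    change setMul (setRan U.1) (setRan V.1) = setMul (setRan V.1) (setRan U.1)
    rw [unit_mul_unit (setRan_subset _) (setRan_subset _),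
      unit_mul_unit (setRan_subset _) (setRan_subset _), Set.inter_comm]
  pl_mul_pl U V := Subtype.ext <| by
    change setRan (setMul (setRan U.1) (setRan V.1)) = setMul (setRan U.1) (setRan V.1)
    rw [unit_mul_unit (setRan_subset _) (setRan_subset _)]
    exact setRan_unit (Set.inter_subset_left.trans (setRan_subset _))
  pl_mul' U V := Subtype.ext <| by
    change setRan (setMul U.1 V.1) = setRan (setMul U.1 (setRan V.1))
    ext z; rw [mem_setRan_mul, mem_setRan_mul, setRan_unit (setRan_subset _)]
  st_pl U := Subtype.ext (setDom_unit (setRan_subset _))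
  pl_st U := Subtype.ext (setRan_unit (setDom_subset _))
  restr U V := Subtype.ext <| by
    change setMul (setDom U.1) V.1 = setMul V.1 (setDom (setMul U.1 V.1))
    ext z; rw [mem_unit_mul (setDom_subset _), mem_mul_unit (setDom_subset _), mem_setDom_mul]
    constructor
    · rintro ⟨h1, h2⟩; exact ⟨h1, z, h1, h2, rfl⟩
    · rintro ⟨h1, y, hy, h2, h3⟩
      rw [(A.isSlice _ V.2).injOn hy h1 h3] at h2
      exact ⟨h1, h2⟩

/-- An algebra of compact bislices is a birestriction semigroup. -/
instance (A : BisliceAlgebra C) : BirestrictionSemigroup A.carrier where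
  corestr U V := Subtype.ext <| by
    change setMul U.1 (setRan V.1) = setMul (setRan (setMul U.1 V.1)) U.1
    ext z; rw [mem_mul_unit (setRan_subset _), mem_unit_mul (setRan_subset _), mem_setRan_mul]
    constructor
    · rintro ⟨h1, h2⟩; exact ⟨h1, z, h1, h2, rfl⟩
    · rintro ⟨h1, x, hx, h2, h3⟩
      rw [(A.isBislice _ U.2).2.injOn hx h1 h3] at h2
      exact ⟨h1, h2⟩

theorem InverseBisliceAlgebra.inv_mul (hC : ∀ x : C, ∃ y, IsInverseArrow x y)
    (A : InverseBisliceAlgebra C) {U : Set C} (hU : U ∈ A.carrier) :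
    setMul (setInv U) U = setDom U := by
  ext z; constructor
  · rintro ⟨y, ⟨x, hx, hxy⟩, x', hx', h, rfl⟩
    obtain ⟨h1, h2, _, h4⟩ := hxy
    have e : x = x' := (A.isBislice U hU).2.injOn hx hx' (by rw [← h2, h])
    subst e
    exact ⟨x, hx, h4.symm⟩
  · rintro ⟨x, hx, rfl⟩
    obtain ⟨y, hy⟩ := hC x
    exact ⟨y, ⟨x, hx, hy⟩, x, hx, hy.2.1, hy.2.2.2⟩

theorem InverseBisliceAlgebra.mul_inv (hC : ∀ x : C, ∃ y, IsInverseArrow x y)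
    (A : InverseBisliceAlgebra C) {U : Set C} (hU : U ∈ A.carrier) :
    setMul U (setInv U) = setRan U := by
  ext z; constructor
  · rintro ⟨x', hx', y, ⟨x, hx, hxy⟩, h, rfl⟩
    obtain ⟨h1, h2, h3, _⟩ := hxy
    have e : x = x' := (A.isBislice U hU).1.injOn hx hx' (by rw [h1, h])
    subst e
    exact ⟨x, hx, h3.symm⟩
  · rintro ⟨x, hx, rfl⟩
    obtain ⟨y, hy⟩ := hC x
    exact ⟨x, hx, y, ⟨x, hx, hy⟩, hy.1, hy.2.2.1⟩

/-- An inverse semigroup of compact bislices of a groupoid, with its derived operations `U^*` and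
`U^+`. -/
def InverseBisliceAlgebra.toBisliceAlgebra (hC : ∀ x : C, ∃ y, IsInverseArrow x y)
    (A : InverseBisliceAlgebra C) : BisliceAlgebra C where
  carrier := A.carrier
  nonempty := A.nonempty
  isSlice U hU := (A.isBislice U hU).1
  isCompact := A.isCompact
  mul_mem := A.mul_mem
  dom_mem U hU := by
    rw [← A.inv_mul hC hU]; exact A.mul_mem _ (A.inv_mem U hU) _ hU
  ran_mem U hU := by
    rw [← A.mul_inv hC hU]; exact A.mul_mem _ hU _ (A.inv_mem U hU)
  isBislice := A.isBislice

theorem IsAmpleGroupoid.exists_inverse (h : IsAmpleGroupoid C) (x : C) :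
    ∃ y, IsInverseArrow x y := by
  obtain ⟨i, _, hi⟩ := h.inversion
  exact ⟨i x, hi x⟩

/-- The ordered category of an algebra of compact slices: `UV` is defined when `U^* = V^+`, the
order is `U = V U^*`, that is, inclusion, and the corestriction of `U` to `E` is `EU`. -/
def SliceAlgebra.ordCat (A : SliceAlgebra C) : OrdCatRC.{u} := ⟨Underlying A.carrier⟩

/-- The inductive category of an algebra of compact bislices. -/
def BisliceAlgebra.indCat (A : BisliceAlgebra C) : IndCat.{u} := ⟨Underlying A.carrier⟩

theorem setDom_setInv (hC : ∀ x : C, ∃ y, IsInverseArrow x y) (U : Set C) :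
    setDom (setInv U) = setRan U := by
  ext z; constructor
  · rintro ⟨y, ⟨x, hx, h1, h2, _⟩, rfl⟩; exact ⟨x, hx, h2.symm⟩
  · rintro ⟨x, hx, rfl⟩
    obtain ⟨y, hy⟩ := hC x
    exact ⟨y, ⟨x, hx, hy⟩, hy.2.1⟩

theorem setRan_setInv (hC : ∀ x : C, ∃ y, IsInverseArrow x y) (U : Set C) :
    setRan (setInv U) = setDom U := by
  ext z; constructor
  · rintro ⟨y, ⟨x, hx, h1, h2, _⟩, rfl⟩; exact ⟨x, hx, h1⟩
  · rintro ⟨x, hx, rfl⟩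
    obtain ⟨y, hy⟩ := hC x
    exact ⟨y, ⟨x, hx, hy⟩, hy.1.symm⟩

theorem InverseBisliceAlgebra.isInductiveGroupoid (hC : ∀ x : C, ∃ y, IsInverseArrow x y)
    (A : InverseBisliceAlgebra C) :
    isInductiveGroupoid (A.toBisliceAlgebra hC).indCat := by
  refine ⟨?_, fun x y x' y' hx hy h => IsInverseArrow.le_of_le hx hy h⟩
  rintro ⟨⟨U, hU⟩⟩
  refine ⟨⟨⟨setInv U, A.inv_mem U hU⟩⟩, ?_, ?_, ?_, ?_⟩
  · exact congrArg Underlying.mk (Subtype.ext (setRan_setInv hC U).symm)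
  · exact congrArg Underlying.mk (Subtype.ext (setDom_setInv hC U))
  · exact congrArg Underlying.mk (Subtype.ext (A.mul_inv hC hU))
  · exact congrArg Underlying.mk (Subtype.ext (A.inv_mul hC hU))

end slices

/-- The inductive groupoid of an inverse semigroup of compact bislices of a groupoid. -/
def InverseBisliceAlgebra.indGpd {C : Type u} [SmallCat C] [TopologicalSpace C]
    (hC : ∀ x : C, ∃ y, IsInverseArrow x y) (A : InverseBisliceAlgebra C) : IndGpd.{u} :=
  ⟨(A.toBisliceAlgebra hC).indCat, A.isInductiveGroupoid hC⟩

/-- Ordered categories with restrictions and corestrictions of compact slices of strongly ample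
categories. -/
def ofCompactSlices : ObjectProperty OrdCatRC.{u} := fun X =>
  ∃ (C : Type u) (_ : SmallCat C) (_ : TopologicalSpace C) (_ : IsStronglyAmple C)
    (A : SliceAlgebra C), X = A.ordCat

/-- Inductive categories of compact bislices of biample categories. -/
def ofCompactBislices : ObjectProperty IndCat.{u} := fun X =>
  ∃ (C : Type u) (_ : SmallCat C) (_ : TopologicalSpace C) (_ : IsBiample C)
    (A : BisliceAlgebra C), X = A.indCat

/-- Inductive groupoids of compact bislices of ample groupoids. -/
def ofCompactBislicesGroupoid : ObjectProperty IndGpd.{u} := fun X =>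
  ∃ (C : Type u) (_ : SmallCat C) (_ : TopologicalSpace C) (hC : IsAmpleGroupoid C)
    (A : InverseBisliceAlgebra C), X = A.indGpd hC.exists_inverse

end ESN

namespace ESN

open SmallCat

/-! ### Ultrafilters of arrows of a small category -/

/-! The assignment `S ↦ 𝒰(S)` is fully faithful. The product of `S` can be recovered from the
ordered category, because `s t` is the composite of `s t⁺` and `s^* t`. With `e = s^* t⁺`, these are
the restriction of `s` and the corestriction of `t` to `e`. A functor that preserves meets of units,
restrictions and corestrictions therefore preserves all products (`RCFunctor.map_mul`). In the
birestriction case corestrictions are unique, so their preservation is automatic. By definition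
every category of compact slices is some `𝒰(A)`. It remains to show that each semigroup is
isomorphic to an algebra of compact slices; `nonempty_equivalence_fullSubcategory` then gives the
equivalence.

The representation starts from the principal ideals of `C = 𝒰(S)`. Uniqueness of restrictions makes
`dom` injective on `Iic s`, and `Iic s · Iic t = Iic (s t)` (`setMul_Iic`), with similar formulas
for domains and ranges. So `S` already acts faithfully by slices of the discrete category `C`. To
make them compact, `C` is replaced by the space of ultrafilters on `C` containing a slice, with the
product generated by the sets `AB`. That product is again an ultrafilter, since on a slice the right
factor determines the left one. The map `U ↦ hat U` is injective on slices and commutes with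
products, domains and ranges (`hat_setMul`, `hat_setDom`, `hat_setRan`, `hat_injective`), and each
`hat U` is a compact slice. The ultrafilters thus form a strongly ample category in which the sets
`hat (Iic s)` are a copy of `S`.

For birestriction semigroups `ran` is injective on principal ideals too, and bislices replace
slices. For inverse semigroups `C` is a groupoid, and inversion passes to ultrafilters containing a
bislice. Conversely, in a birestriction semigroup whose underlying category is a groupoid every
idempotent is a projection (`st_eq_self_of_idem`), so the semigroup is inverse. -/

/-- Since `f '' W ∈ p`, every preimage of a member of `p` meets `W`. The filter generated by these
preimages and `W` is thus proper, and any ultrafilter refining it will do. -/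
theorem exists_ultrafilter_map_eq {X Y : Type*} (f : X → Y) (W : Set X) (p : Ultrafilter Y)
    (h : f '' W ∈ p) : ∃ q : Ultrafilter X, W ∈ q ∧ q.map f = p := by
  have hne : (Filter.comap f p ⊓ Filter.principal W).NeBot := by
    rw [Filter.inf_principal_neBot_iff]
    rintro A ⟨B, hB, hA⟩
    obtain ⟨_, h1, x, hx, rfl⟩ := p.nonempty_of_mem (Filter.inter_mem hB h)
    exact ⟨x, hA h1, hx⟩
  refine ⟨Ultrafilter.of (Filter.comap f p ⊓ Filter.principal W), ?_, ?_⟩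
  · exact Ultrafilter.of_le _ (Filter.mem_inf_of_right (Filter.mem_principal_self W))
  -- Comparable ultrafilters are equal, so one inclusion suffices; the same device recurs below.
  · refine Ultrafilter.coe_le_coe.1 fun A hA => ?_
    exact Ultrafilter.of_le _ (Filter.mem_inf_of_left (Filter.preimage_mem_comap hA))

/-- Injectivity on `U` recovers `W ∩ U` from its image: a point of `U` whose value lies in `f '' (W
∩ U)` is in `W`. -/
theorem ultrafilter_eq_of_map_eq {X Y : Type*} {f : X → Y} {U : Set X} (hf : Set.InjOn f U)
    {p q : Ultrafilter X} (hp : U ∈ p) (hq : U ∈ q) (h : p.map f = q.map f) : p = q := by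
  symm
  refine Ultrafilter.coe_le_coe.1 fun W hW => ?_
  have h1 : f '' (W ∩ U) ∈ p.map f := Filter.image_mem_map (Filter.inter_mem hW hp)
  rw [h] at h1
  filter_upwards [Ultrafilter.mem_map.1 h1, hq] with x hx hxU
  obtain ⟨y, ⟨hy, hyU⟩, hxy⟩ := hx
  exact hf hyU hxU hxy ▸ hy

/-- A family of subsets of a small category, on which `dom` is injective, that is closed under
subsets and products and contains the set of units. -/
structure SliceFamily (C : Type u) [SmallCat C] where
  good : Set C → Prop
  mono : ∀ {U V : Set C}, U ⊆ V → good V → good U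
  units : good (units C)
  mul : ∀ {U V : Set C}, good U → good V → good (setMul U V)
  injOn : ∀ {U : Set C}, good U → Set.InjOn dom U

section spectrum

variable {C : Type u} [SmallCat C]

theorem setMul_mono {U U' V V' : Set C} (h : U ⊆ U') (k : V ⊆ V') :
    setMul U V ⊆ setMul U' V' := by
  rintro _ ⟨x, hx, y, hy, hxy, rfl⟩
  exact ⟨x, h hx, y, k hy, hxy, rfl⟩

theorem injOn_dom_setMul {U V : Set C} (hU : Set.InjOn dom U) (hV : Set.InjOn dom V) :
    Set.InjOn dom (setMul U V) := by
  rintro _ ⟨x, hx, y, hy, h, rfl⟩ _ ⟨x', hx', y', hy', h', rfl⟩ e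
  rw [dom_comp, dom_comp] at e
  have e1 := hV hy hy' e
  subst e1
  have e2 := hU hx hx' (h.trans h'.symm)
  subst e2
  rfl

theorem injOn_ran_setMul {U V : Set C} (hU : Set.InjOn ran U) (hV : Set.InjOn ran V) :
    Set.InjOn ran (setMul U V) := by
  rintro _ ⟨x, hx, y, hy, h, rfl⟩ _ ⟨x', hx', y', hy', h', rfl⟩ e
  rw [ran_comp, ran_comp] at e
  have e1 := hU hx hx' e
  subst e1
  have e2 := hV hy hy' (h.symm.trans h')
  subst e2
  rfl

theorem injOn_dom_units : Set.InjOn dom (units C) := fun x hx y hy h => by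
  rwa [dom_unit x hx, dom_unit y hy] at h

theorem injOn_ran_units : Set.InjOn ran (units C) := fun x hx y hy h => by
  rwa [ran_unit x hx, ran_unit y hy] at h

variable (C) in
/-- All sets on which `dom` is injective. -/
def SliceFamily.slices : SliceFamily C where
  good U := Set.InjOn dom U
  mono h k := k.mono h
  units := injOn_dom_units
  mul := injOn_dom_setMul
  injOn h := h

variable (C) in
/-- All sets on which `dom` and `ran` are injective. -/
def SliceFamily.bislices : SliceFamily C where
  good U := Set.InjOn dom U ∧ Set.InjOn ran U
  mono h k := ⟨k.1.mono h, k.2.mono h⟩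
  units := ⟨injOn_dom_units, injOn_ran_units⟩
  mul h k := ⟨injOn_dom_setMul h.1 k.1, injOn_ran_setMul h.2 k.2⟩
  injOn h := h.1

/-- The filter generated by the products `AB`, `A ∈ p`, `B ∈ q`. -/
def mulFilter (p q : Filter C) : Filter C where
  sets := {W | ∃ A ∈ p, ∃ B ∈ q, setMul A B ⊆ W}
  univ_sets := ⟨Set.univ, Filter.univ_mem, Set.univ, Filter.univ_mem, Set.subset_univ _⟩
  sets_of_superset := by
    rintro W W' ⟨A, hA, B, hB, h⟩ hW
    exact ⟨A, hA, B, hB, h.trans hW⟩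
  inter_sets := by
    rintro W W' ⟨A, hA, B, hB, h⟩ ⟨A', hA', B', hB', h'⟩
    exact ⟨A ∩ A', Filter.inter_mem hA hA', B ∩ B', Filter.inter_mem hB hB', Set.subset_inter
      ((setMul_mono Set.inter_subset_left Set.inter_subset_left).trans h)
      ((setMul_mono Set.inter_subset_right Set.inter_subset_right).trans h')⟩

theorem setMul_mem_mulFilter {p q : Filter C} {A B : Set C} (hA : A ∈ p) (hB : B ∈ q) :
    setMul A B ∈ mulFilter p q := ⟨A, hA, B, hB, subset_rfl⟩

/-- The set `dom '' A` belongs to `p.map dom = q.map ran`, so some `y ∈ B` has its range there and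
can be composed with an element of `A`. -/
theorem mulFilter_neBot {p q : Ultrafilter C} (h : p.map dom = q.map ran) :
    (mulFilter (p : Filter C) q).NeBot := by
  rw [Filter.neBot_iff]
  intro hbot
  have h0 : (∅ : Set C) ∈ mulFilter (p : Filter C) q := by rw [hbot]; trivial
  obtain ⟨A, hA, B, hB, hAB⟩ := h0
  have h1 : dom '' A ∈ p.map dom := Filter.image_mem_map hA
  rw [h] at h1
  obtain ⟨y, hy, x, hx, hxy⟩ := q.nonempty_of_mem (Filter.inter_mem hB (Ultrafilter.mem_map.1 h1))
  exact hAB ⟨x, hx, y, hy, hxy, rfl⟩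

/-- The product of the ultrafilters `p` and `q`, where `p` contains a set on which `dom` is
injective. -/
def mulUltrafilter (p q : Ultrafilter C) (h : p.map dom = q.map ran)
    (hp : ∃ U ∈ p, Set.InjOn (dom : C → C) U) : Ultrafilter C :=
  Ultrafilter.ofComplNotMemIff (mulFilter (p : Filter C) q) fun W => by
    have := mulFilter_neBot h
    refine ⟨fun hW => ?_, fun hW hW' => Filter.compl_notMem hW hW'⟩
    obtain ⟨U, hU, hinj⟩ := hp
    -- An element `y` has at most one partner `x ∈ U`, so `q` decides whether `x y ∈ W`. Either `U`
    -- times this set lies in `W`, or `U` times its complement lies in the complement of `W`.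
    rcases q.mem_or_compl_mem {y | ∃ x ∈ U, ∃ h : dom x = ran y, comp x y h ∈ W} with hB | hB
    · refine ⟨U, hU, _, hB, ?_⟩
      rintro _ ⟨x, hx, y, ⟨x', hx', h', hW'⟩, hxy, rfl⟩
      have e := hinj hx hx' (hxy.trans h'.symm)
      subst e
      exact hW'
    · refine absurd ⟨U, hU, _, hB, ?_⟩ hW
      rintro _ ⟨x, hx, y, hy, hxy, rfl⟩ hxW
      exact hy ⟨x, hx, hxy, hxW⟩

variable (𝒢 : SliceFamily C)

/-- The ultrafilters that contain a member of the family `𝒢`. -/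
def SliceUltrafilter : Type u := {q : Ultrafilter C // ∃ U ∈ q, 𝒢.good U}

instance : TopologicalSpace (SliceUltrafilter 𝒢) :=
  inferInstanceAs (TopologicalSpace {q : Ultrafilter C // ∃ U ∈ q, 𝒢.good U})

instance : T2Space (SliceUltrafilter 𝒢) :=
  inferInstanceAs (T2Space {q : Ultrafilter C // ∃ U ∈ q, 𝒢.good U})

variable {𝒢}

theorem units_mem_map_dom (q : Ultrafilter C) : units C ∈ q.map dom :=
  Ultrafilter.mem_map.2 (Filter.univ_mem' dom_mem_units)

theorem units_mem_map_ran (q : Ultrafilter C) : units C ∈ q.map ran :=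
  Ultrafilter.mem_map.2 (Filter.univ_mem' ran_mem_units)

theorem SliceUltrafilter.exists_injOn (p : SliceUltrafilter 𝒢) :
    ∃ U ∈ p.1, Set.InjOn (dom : C → C) U := by
  obtain ⟨U, hU, hg⟩ := p.2
  exact ⟨U, hU, 𝒢.injOn hg⟩

theorem map_eq_self {f : C → C} (hf : ∀ x ∈ units C, f x = x) {q : Ultrafilter C}
    (hq : units C ∈ q) : q.map f = q := by
  refine Ultrafilter.coe_le_coe.1 fun A hA => ?_
  refine Ultrafilter.mem_map.2 ?_
  filter_upwards [hA, hq] with x hx hxu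
  change f x ∈ A
  rwa [hf x hxu]

/-- The category of the ultrafilters that contain a member of `𝒢`. -/
instance : SmallCat (SliceUltrafilter 𝒢) where
  dom q := ⟨q.1.map dom, units C, units_mem_map_dom q.1, 𝒢.units⟩
  ran q := ⟨q.1.map ran, units C, units_mem_map_ran q.1, 𝒢.units⟩
  comp p q h := ⟨mulUltrafilter p.1 q.1 (congrArg Subtype.val h) p.exists_injOn, by
    obtain ⟨U, hU, hU'⟩ := p.2
    obtain ⟨V, hV, hV'⟩ := q.2
    exact ⟨setMul U V, setMul_mem_mulFilter hU hV, 𝒢.mul hU' hV'⟩⟩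
  range_dom := by
    ext x; constructor
    · rintro ⟨y, rfl⟩
      exact ⟨⟨y.1.map dom, units C, units_mem_map_dom y.1, 𝒢.units⟩,
        Subtype.ext (map_eq_self ran_unit (units_mem_map_dom _))⟩
    · rintro ⟨y, rfl⟩
      exact ⟨⟨y.1.map ran, units C, units_mem_map_ran y.1, 𝒢.units⟩,
        Subtype.ext (map_eq_self dom_unit (units_mem_map_ran _))⟩
  dom_unit := by
    rintro _ ⟨y, rfl⟩
    exact Subtype.ext (map_eq_self dom_unit (units_mem_map_dom _))
  ran_unit := by
    rintro _ ⟨y, rfl⟩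
    exact Subtype.ext (map_eq_self ran_unit (units_mem_map_dom _))
  dom_comp p q h := by
    refine Subtype.ext (Ultrafilter.coe_le_coe.1 fun A hA => ?_)
    refine ⟨Set.univ, Filter.univ_mem, _, hA, ?_⟩
    rintro _ ⟨x, -, y, hy, hxy, rfl⟩
    change dom _ ∈ A
    rwa [dom_comp]
  ran_comp p q h := by
    refine Subtype.ext (Ultrafilter.coe_le_coe.1 fun A hA => ?_)
    refine ⟨_, hA, Set.univ, Filter.univ_mem, ?_⟩
    rintro _ ⟨x, hx, y, -, hxy, rfl⟩
    change ran _ ∈ A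
    rwa [ran_comp]
  assoc p q r h k := by
    refine Subtype.ext (Ultrafilter.coe_le_coe.1 ?_)
    -- A member of `p(qr)` contains some `A(BE) = (AB)E`, so it is a member of `(pq)r`.
    rintro W ⟨A, hA, D, ⟨B, hB, E, hE, hD⟩, hW⟩
    refine ⟨setMul A B, setMul_mem_mulFilter hA hB, E, hE, ?_⟩
    rw [setMul_assoc]
    exact (setMul_mono subset_rfl hD).trans hW
  ran_mul q h := by
    refine Subtype.ext (Ultrafilter.coe_le_coe.1 fun W hW => ?_)
    refine ⟨units C, units_mem_map_ran q.1, W, hW, ?_⟩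
    intro z hz
    exact ((mem_unit_mul subset_rfl).1 hz).1
  mul_dom q h := by
    refine Subtype.ext (Ultrafilter.coe_le_coe.1 fun W hW => ?_)
    refine ⟨W, hW, units C, units_mem_map_dom q.1, ?_⟩
    intro z hz
    exact ((mem_mul_unit subset_rfl).1 hz).1

theorem SliceUltrafilter.mem_units_iff {q : SliceUltrafilter 𝒢} :
    q ∈ units (SliceUltrafilter 𝒢) ↔ units C ∈ q.1 := by
  constructor
  · rintro ⟨y, rfl⟩
    exact units_mem_map_dom y.1
  · intro h
    exact ⟨q, Subtype.ext (map_eq_self dom_unit h)⟩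

/-! ### Basic open sets and their products, domains and ranges -/

variable (𝒢) in
/-- The set of the ultrafilters that contain `U`. -/
def hat (U : Set C) : Set (SliceUltrafilter 𝒢) := {q | U ∈ q.1}

theorem isOpen_hat (U : Set C) : IsOpen (hat 𝒢 U) :=
  (ultrafilter_isOpen_basic U).preimage continuous_subtype_val

/-- A basic neighbourhood of `q` may be cut down by a good member of `q`, since goodness passes to
subsets. -/
theorem isTopologicalBasis_hat :
    TopologicalSpace.IsTopologicalBasis {A | ∃ U : Set C, 𝒢.good U ∧ A = hat 𝒢 U} := by
  refine TopologicalSpace.isTopologicalBasis_of_isOpen_of_nhds ?_ ?_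
  · rintro _ ⟨U, -, rfl⟩; exact isOpen_hat U
  · intro q O hq hO
    obtain ⟨O', hO', rfl⟩ := isOpen_induced_iff.1 hO
    obtain ⟨_, ⟨W, rfl⟩, hqW, hW⟩ := ultrafilterBasis_is_basis.exists_subset_of_mem_open
      (show q.1 ∈ O' from hq) hO'
    obtain ⟨U, hU, hg⟩ := q.2
    refine ⟨_, ⟨W ∩ U, 𝒢.mono Set.inter_subset_right hg, rfl⟩, Filter.inter_mem hqW hU, ?_⟩
    intro p hp
    exact hW (show W ∈ p.1 from Filter.mem_of_superset hp Set.inter_subset_left)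

/-- As `U` is good, every ultrafilter on `C` containing `U` belongs to the space. Hence `hat 𝒢 U` is
a closed subset of the compact space of all ultrafilters. -/
theorem isCompact_hat {U : Set C} (hU : 𝒢.good U) : IsCompact (hat 𝒢 U) := by
  have hemb : Topology.IsEmbedding (fun q : SliceUltrafilter 𝒢 => q.1) :=
    Topology.IsEmbedding.subtypeVal
  rw [hemb.isCompact_iff]
  have : (fun q : SliceUltrafilter 𝒢 => q.1) '' hat 𝒢 U = {q : Ultrafilter C | U ∈ q} := by
    ext q; constructor
    · rintro ⟨p, hp, rfl⟩; exact hp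
    · intro hq; exact ⟨⟨q, U, hq, hU⟩, hq, rfl⟩
  rw [this]
  exact (ultrafilter_isClosed_basic U).isCompact

theorem setDom_hat (U : Set C) : setDom (hat 𝒢 U) ⊆ hat 𝒢 (setDom U) := by
  rintro _ ⟨q, hq, rfl⟩
  exact Filter.image_mem_map hq

/-- An ultrafilter containing `setDom U` lifts along `dom` to one containing `U`; goodness of `U`
keeps the lift in the space. -/
theorem hat_setDom {U : Set C} (hU : 𝒢.good U) : hat 𝒢 (setDom U) = setDom (hat 𝒢 U) := by
  refine Set.Subset.antisymm (fun p hp => ?_) (setDom_hat U)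
  obtain ⟨q, hq, hqp⟩ := exists_ultrafilter_map_eq dom U p.1 hp
  exact ⟨⟨q, U, hq, hU⟩, hq, Subtype.ext hqp⟩

theorem setRan_hat (U : Set C) : setRan (hat 𝒢 U) ⊆ hat 𝒢 (setRan U) := by
  rintro _ ⟨q, hq, rfl⟩
  exact Filter.image_mem_map hq

theorem hat_setRan {U : Set C} (hU : 𝒢.good U) : hat 𝒢 (setRan U) = setRan (hat 𝒢 U) := by
  refine Set.Subset.antisymm (fun p hp => ?_) (setRan_hat U)
  obtain ⟨q, hq, hqp⟩ := exists_ultrafilter_map_eq ran U p.1 hp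
  exact ⟨⟨q, U, hq, hU⟩, hq, Subtype.ext hqp⟩

/-- An ultrafilter containing `UV` is the image, under composition, of an ultrafilter of composable
pairs from `U × V`. The two projections of that ultrafilter are the required factors. -/
theorem hat_setMul {U V : Set C} (hU : 𝒢.good U) (hV : 𝒢.good V) :
    hat 𝒢 (setMul U V) = setMul (hat 𝒢 U) (hat 𝒢 V) := by
  ext q; constructor
  · intro hq
    let m : {z : C × C // dom z.1 = ran z.2} → C := fun z => comp z.1.1 z.1.2 z.2
    have himg : m '' {z | z.1.1 ∈ U ∧ z.1.2 ∈ V} ∈ q.1 := by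
      refine Filter.mem_of_superset hq ?_
      rintro _ ⟨x, hx, y, hy, h, rfl⟩
      exact ⟨⟨(x, y), h⟩, ⟨hx, hy⟩, rfl⟩
    obtain ⟨r, hr, hrq⟩ := exists_ultrafilter_map_eq m _ q.1 himg
    have h1 : U ∈ r.map fun z => z.1.1 :=
      Ultrafilter.mem_map.2 (Filter.mem_of_superset hr fun _ hz => hz.1)
    have h2 : V ∈ r.map fun z => z.1.2 :=
      Ultrafilter.mem_map.2 (Filter.mem_of_superset hr fun _ hz => hz.2)
    have h3 : (r.map fun z => z.1.1).map dom = (r.map fun z => z.1.2).map ran := by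
      rw [Ultrafilter.map_map, Ultrafilter.map_map]
      exact congrArg r.map (funext fun z => z.2)
    refine ⟨⟨_, U, h1, hU⟩, h1, ⟨_, V, h2, hV⟩, h2, Subtype.ext h3, Subtype.ext ?_⟩
    symm
    refine Ultrafilter.coe_le_coe.1 ?_
    rintro W ⟨A, hA, B, hB, hAB⟩
    rw [← hrq]
    refine Ultrafilter.mem_map.2 ?_
    filter_upwards [Ultrafilter.mem_map.1 hA, Ultrafilter.mem_map.1 hB] with z hzA hzB
    exact hAB ⟨_, hzA, _, hzB, z.2, rfl⟩
  · rintro ⟨p, hp, q, hq, h, rfl⟩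
    exact setMul_mem_mulFilter hp hq

/-- The points of `U` are detected by the principal ultrafilters in `hat 𝒢 U`. -/
theorem hat_injective {U V : Set C} (hU : 𝒢.good U) (hV : 𝒢.good V) (h : hat 𝒢 U = hat 𝒢 V) :
    U = V := by
  ext x; constructor
  · intro hx
    have : (⟨pure x, U, hx, hU⟩ : SliceUltrafilter 𝒢) ∈ hat 𝒢 U := hx
    rw [h] at this
    exact this
  · intro hx
    have : (⟨pure x, V, hx, hV⟩ : SliceUltrafilter 𝒢) ∈ hat 𝒢 V := hx
    rw [← h] at this
    exact this

/-! ### The topology of the ultrafilter category -/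

variable (𝒢) in
theorem isTopologicalCat_sliceUltrafilter : IsTopologicalCat (SliceUltrafilter 𝒢) where
  continuous_dom := by
    refine Continuous.subtype_mk ?_ _
    refine isTopologicalBasis_hat.continuous_iff.2 ?_
    rintro _ ⟨U, -, rfl⟩
    exact isOpen_hat (dom ⁻¹' U)
  continuous_ran := by
    refine Continuous.subtype_mk ?_ _
    refine isTopologicalBasis_hat.continuous_iff.2 ?_
    rintro _ ⟨U, -, rfl⟩
    exact isOpen_hat (ran ⁻¹' U)
  continuous_comp := by
    refine isTopologicalBasis_hat.continuous_iff.2 ?_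
    rintro _ ⟨W, -, rfl⟩
    refine isOpen_iff_mem_nhds.2 ?_
    -- If `AB ⊆ W` witnesses `W ∈ pq`, the same sets witness it for every composable pair in `hat A
    -- × hat B`.
    rintro ⟨⟨p, q⟩, h⟩ ⟨A, hA, B, hB, hAB⟩
    have ho : IsOpen ((fun z : {z : SliceUltrafilter 𝒢 × SliceUltrafilter 𝒢 //
        dom z.1 = ran z.2} => z.1) ⁻¹' (hat 𝒢 A ×ˢ hat 𝒢 B)) :=
      ((isOpen_hat A).prod (isOpen_hat B)).preimage continuous_subtype_val
    refine Filter.mem_of_superset (ho.mem_nhds ⟨hA, hB⟩) ?_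
    rintro ⟨⟨p', q'⟩, h'⟩ ⟨hA', hB'⟩
    exact ⟨A, hA', B, hB', hAB⟩

variable (𝒢) in
theorem isOpenMap_domU : IsOpenMap (domU (SliceUltrafilter 𝒢)) := by
  refine isTopologicalBasis_hat.isOpenMap_iff.2 ?_
  rintro _ ⟨U, hU, rfl⟩
  convert (isOpen_hat (𝒢 := 𝒢) (setDom U)).preimage continuous_subtype_val
  rw [hat_setDom hU]
  ext p; constructor
  · rintro ⟨q, hq, rfl⟩; exact ⟨q, hq, rfl⟩
  · rintro ⟨q, hq, h⟩; exact ⟨q, hq, Subtype.ext h⟩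

variable (𝒢) in
theorem isOpenMap_ranU : IsOpenMap (ranU (SliceUltrafilter 𝒢)) := by
  refine isTopologicalBasis_hat.isOpenMap_iff.2 ?_
  rintro _ ⟨U, hU, rfl⟩
  convert (isOpen_hat (𝒢 := 𝒢) (setRan U)).preimage continuous_subtype_val
  rw [hat_setRan hU]
  ext p; constructor
  · rintro ⟨q, hq, rfl⟩; exact ⟨q, hq, rfl⟩
  · rintro ⟨q, hq, h⟩; exact ⟨q, hq, Subtype.ext h⟩

theorem isSlice_hat {U : Set C} (hU : Set.InjOn dom U) : IsSlice (hat 𝒢 U) := by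
  refine ⟨isOpen_hat U, .of_continuous_injective_isOpenMap
    ((isTopologicalCat_sliceUltrafilter 𝒢).continuous_dom.comp continuous_subtype_val) ?_
    ((isOpenMap_domU 𝒢).comp (isOpen_hat U).isOpenMap_subtype_val)⟩
  rintro ⟨p, hp⟩ ⟨q, hq⟩ h
  have h1 : p.1.map dom = q.1.map dom := congrArg (fun z => z.1.1) h
  exact Subtype.ext (Subtype.ext (ultrafilter_eq_of_map_eq hU hp hq h1))

theorem isCoslice_hat {U : Set C} (hU : Set.InjOn ran U) : IsCoslice (hat 𝒢 U) := by
  refine ⟨isOpen_hat U, .of_continuous_injective_isOpenMap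
    ((isTopologicalCat_sliceUltrafilter 𝒢).continuous_ran.comp continuous_subtype_val) ?_
    ((isOpenMap_ranU 𝒢).comp (isOpen_hat U).isOpenMap_subtype_val)⟩
  rintro ⟨p, hp⟩ ⟨q, hq⟩ h
  have h1 : p.1.map ran = q.1.map ran := congrArg (fun z => z.1.1) h
  exact Subtype.ext (Subtype.ext (ultrafilter_eq_of_map_eq hU hp hq h1))

-- The unit space is `hat 𝒢 (units C)`, and the units form a good set.
variable (𝒢) in
theorem compactSpace_units : CompactSpace (units (SliceUltrafilter 𝒢)) := by
  have : units (SliceUltrafilter 𝒢) = hat 𝒢 (units C) :=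
    Set.ext fun _ => SliceUltrafilter.mem_units_iff
  rw [← isCompact_iff_compactSpace, this]
  exact isCompact_hat 𝒢.units

variable (𝒢) in
theorem isEtale_sliceUltrafilter : IsEtale (SliceUltrafilter 𝒢) where
  toIsTopologicalCat := isTopologicalCat_sliceUltrafilter 𝒢
  locallyCompact := by
    have := compactSpace_units 𝒢
    infer_instance
  hausdorff := inferInstance
  localHomeo_dom := by
    refine isLocalHomeomorph_iff_isOpenEmbedding_restrict.2 fun q => ?_
    obtain ⟨U, hU, hg⟩ := q.2
    exact ⟨hat 𝒢 U, (isOpen_hat U).mem_nhds hU, (isSlice_hat (𝒢.injOn hg)).2⟩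

variable (𝒢) in
theorem isStronglyAmple_sliceUltrafilter : IsStronglyAmple (SliceUltrafilter 𝒢) where
  toIsEtale := isEtale_sliceUltrafilter 𝒢
  isOpenMap_ran := isOpenMap_ranU 𝒢
  basis := by
    refine TopologicalSpace.isTopologicalBasis_of_isOpen_of_nhds (fun U hU => hU.1.1) ?_
    intro q O hq hO
    obtain ⟨_, ⟨U, hU, rfl⟩, h1, h2⟩ :=
      isTopologicalBasis_hat.exists_subset_of_mem_open hq hO
    exact ⟨_, ⟨isSlice_hat (𝒢.injOn hU), isCompact_hat hU⟩, h1, h2⟩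

variable (C) in
theorem isBiample_sliceUltrafilter : IsBiample (SliceUltrafilter (.bislices C)) where
  toIsEtale := isEtale_sliceUltrafilter _
  localHomeo_ran := by
    refine isLocalHomeomorph_iff_isOpenEmbedding_restrict.2 fun q => ?_
    obtain ⟨U, hU, hg⟩ := q.2
    exact ⟨hat _ U, (isOpen_hat U).mem_nhds hU, (isCoslice_hat hg.2).2⟩
  basis := by
    refine TopologicalSpace.isTopologicalBasis_of_isOpen_of_nhds (fun U hU => hU.1.1.1) ?_
    intro q O hq hO
    obtain ⟨_, ⟨U, hU, rfl⟩, h1, h2⟩ :=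
      isTopologicalBasis_hat.exists_subset_of_mem_open hq hO
    exact ⟨_, ⟨⟨isSlice_hat hU.1, isCoslice_hat hU.2⟩, isCompact_hat hU⟩, h1, h2⟩

/-! ### Inversion of ultrafilters over a groupoid -/

theorem IsInverseArrow.symm {x y : C} (h : IsInverseArrow x y) : IsInverseArrow y x := by
  obtain ⟨h1, h2, h3, h4⟩ := h
  exact ⟨h2, h1, h4.trans h1, h3.trans h2.symm⟩

theorem IsInverseArrow.unique {x y z : C} (hy : IsInverseArrow x y) (hz : IsInverseArrow x z) :
    y = z := by
  obtain ⟨y1, y2, y3, y4⟩ := hy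
  obtain ⟨z1, z2, z3, z4⟩ := hz
  have e1 : comp y (comp x z z1) (by rw [ran_comp, y2]) = y := by
    rw [comp_congr rfl z3 _ (by rw [ran_ran, y2])]
    exact comp_dom_right _ _ (ran_mem_units x) _
  have e2 : comp (comp y x y2) z (by rw [dom_comp, z1]) = z := by
    rw [comp_congr y4 rfl _ (by rw [dom_dom, z1])]
    exact comp_ran_left _ _ (dom_mem_units x) _
  rw [← e1, ← assoc y x z y2 z1, e2]

/-- The ultrafilter of the sets `A⁻¹`, `A ∈ q`. -/
def SliceUltrafilter.inv (i : C → C) (hi : ∀ x, IsInverseArrow x (i x))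
    (q : SliceUltrafilter (.bislices C)) : SliceUltrafilter (.bislices C) :=
  ⟨q.1.map i, by
    obtain ⟨U, hU, hd, hr⟩ := q.2
    refine ⟨i '' U, Filter.image_mem_map hU, ?_, ?_⟩
    · rintro _ ⟨x, hx, rfl⟩ _ ⟨y, hy, rfl⟩ h
      rw [(hi x).2.1, (hi y).2.1] at h
      rw [hr hx hy h]
    · rintro _ ⟨x, hx, rfl⟩ _ ⟨y, hy, rfl⟩ h
      rw [← (hi x).1, ← (hi y).1] at h
      rw [hd hx hy h]⟩

/-- Let `A` be contained in a bislice. Injectivity of `dom` on `A` leaves only the products `x x⁻¹`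
in `A A⁻¹`, and injectivity of `ran` leaves only the products `x⁻¹ x` in `A⁻¹ A`. -/
theorem SliceUltrafilter.isInverseArrow_inv {i : C → C} (hi : ∀ x, IsInverseArrow x (i x))
    (q : SliceUltrafilter (.bislices C)) : IsInverseArrow q (q.inv i hi) := by
  have h1 : q.1.map dom = (q.1.map i).map ran := by
    rw [Ultrafilter.map_map]; exact congrArg q.1.map (funext fun x => (hi x).1)
  have h2 : (q.1.map i).map dom = q.1.map ran := by
    rw [Ultrafilter.map_map]; exact congrArg q.1.map (funext fun x => (hi x).2.1)
  obtain ⟨U, hU, hd, hr⟩ := q.2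
  refine ⟨Subtype.ext h1, Subtype.ext h2, Subtype.ext (Ultrafilter.coe_le_coe.1 fun W hW => ?_),
    Subtype.ext (Ultrafilter.coe_le_coe.1 fun W hW => ?_)⟩
  · have hA := Filter.inter_mem (Ultrafilter.mem_map.1 hW) hU
    refine ⟨_, hA, _, Filter.image_mem_map hA, ?_⟩
    rintro _ ⟨x, ⟨hxW, hxU⟩, _, ⟨y, ⟨-, hyU⟩, rfl⟩, h, rfl⟩
    have e := hd hxU hyU (h.trans (hi y).1.symm)
    subst e
    rw [(hi x).2.2.1]
    exact hxW
  · have hA := Filter.inter_mem (Ultrafilter.mem_map.1 hW) hU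
    refine ⟨_, Filter.image_mem_map hA, _, hA, ?_⟩
    rintro _ ⟨_, ⟨y, ⟨-, hyU⟩, rfl⟩, x, ⟨hxW, hxU⟩, h, rfl⟩
    have e := hr hxU hyU (h.symm.trans (hi y).2.1)
    subst e
    rw [(hi x).2.2.2]
    exact hxW

theorem isAmpleGroupoid_sliceUltrafilter (hC : ∀ x : C, ∃ y, IsInverseArrow x y) :
    IsAmpleGroupoid (SliceUltrafilter (.bislices C)) where
  toIsAmple := (isStronglyAmple_sliceUltrafilter _).toIsAmple
  inversion := by
    choose i hi using hC
    refine ⟨SliceUltrafilter.inv i hi, ?_, SliceUltrafilter.isInverseArrow_inv hi⟩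
    refine isTopologicalBasis_hat.continuous_iff.2 ?_
    rintro _ ⟨U, -, rfl⟩
    exact isOpen_hat (i ⁻¹' U)

/-- Inverses are unique, so inversion is an involution `i` with `setInv U = i ⁻¹' U`, and the
inverse of an ultrafilter is its image under `i`. -/
theorem setInv_hat (hC : ∀ x : C, ∃ y, IsInverseArrow x y) (U : Set C) :
    setInv (hat (.bislices C) U) = hat (.bislices C) (setInv U) := by
  choose i hi using hC
  have hii : ∀ x, i (i x) = x := fun x => (hi (i x)).unique (hi x).symm
  have hU : setInv U = i ⁻¹' U := by
    ext y; constructor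
    · rintro ⟨x, hx, hxy⟩
      rw [← (hi x).unique hxy]
      change i (i x) ∈ U
      rwa [hii]
    · intro hy
      exact ⟨i y, hy, (hi y).symm⟩
  rw [hU]
  ext q; constructor
  · rintro ⟨p, hp, hpq⟩
    rw [← (p.isInverseArrow_inv hi).unique hpq]
    refine Filter.mem_of_superset (show U ∈ p.1 from hp) fun x hx => ?_
    change i (i x) ∈ U
    rwa [hii]
  · intro hq
    exact ⟨q.inv i hi, hq, (q.isInverseArrow_inv hi).symm⟩

end spectrum

/-! ### Principal ideals of the ordered category of a range semigroup -/

section ideals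

theorem injOn_dom_Iic {C : Type u} [OrderedCat C] (s : C) : Set.InjOn dom (Set.Iic s) :=
  fun _ hx y hy h =>
    (OrderedCat.restriction (dom y) (dom_mem_units y) s (OrderedCat.dom_mono y s hy)).unique
      ⟨hx, h⟩ ⟨hy, rfl⟩

/-- This is uniqueness of corestrictions, the property that makes principal ideals bislices and not
only slices. -/
theorem injOn_ran_Iic {C : Type u} [InductiveCat C] (s : C) : Set.InjOn ran (Set.Iic s) :=
  fun _ hx y hy h =>
    (InductiveCat.corestriction (ran y) (ran_mem_units y) s (OrderedCat.ran_mono y s hy)).unique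
      ⟨hx, h⟩ ⟨hy, rfl⟩

theorem setDom_Iic {C : Type u} [OrderedCat C] (s : C) :
    setDom (Set.Iic s) = Set.Iic (dom s) := by
  ext e; constructor
  · rintro ⟨x, hx, rfl⟩; exact OrderedCat.dom_mono x s hx
  · intro he
    have h1 := eq_dom_of_le_unit (dom_mem_units s) he
    obtain ⟨t, ⟨ht, hte⟩, -⟩ := OrderedCat.restriction e (h1 ▸ dom_mem_units e) s he
    exact ⟨t, ht, hte⟩

theorem setRan_Iic {C : Type u} [OrderedCatRC C] (s : C) :
    setRan (Set.Iic s) = Set.Iic (ran s) := by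
  ext e; constructor
  · rintro ⟨x, hx, rfl⟩; exact OrderedCat.ran_mono x s hx
  · intro he
    have h1 := eq_dom_of_le_unit (ran_mem_units s) he
    obtain ⟨t, ht, hte⟩ := OrderedCatRC.corestriction e (h1 ▸ dom_mem_units e) s he
    exact ⟨t, ht.1.1, hte⟩

/-- Everything below a unit is a unit and so equals its own range. This lets `isCorestriction_iff`
compute meets of projections as products. -/
theorem isMeet_iff_isCorestriction {C : Type u} [OrderedCat C] {e f g : C} (hf : f ∈ units C) :
    IsMeet e f g ↔ IsCorestriction e f g := by
  have key : ∀ h ≤ f, h ∈ units C := fun h hh => by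
    rw [eq_dom_of_le_unit hf hh]; exact dom_mem_units h
  constructor
  · rintro ⟨hg, h1, h2, h3⟩
    refine ⟨⟨h2, by rwa [ran_unit g hg]⟩, ?_⟩
    rintro h ⟨h4, h5⟩
    rw [ran_unit h (key h h4)] at h5
    exact h3 h (key h h4) h5 h4
  · rintro ⟨⟨h1, h2⟩, h3⟩
    rw [ran_unit g (key g h1)] at h2
    exact ⟨key g h1, h2, h1, fun h hh h4 h5 => h3 ⟨h5, by rwa [ran_unit h hh]⟩⟩

open BiEhresmannSemigroup

variable {S : Type u} [RangeSemigroup S]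

theorem isMeet_underlying_iff {e f g : Underlying S} (he : e ∈ units (Underlying S))
    (hf : f ∈ units (Underlying S)) : IsMeet e f g ↔ g.val = e.val * f.val := by
  rw [isMeet_iff_isCorestriction hf, isCorestriction_iff he]

theorem mul_st_le (s e : S) : (⟨s * st e⟩ : Underlying S) ≤ ⟨s⟩ := by
  change s * st e = s * st (s * st e)
  rw [st_mul, st_mul_st, ← mul_assoc, mul_st]

theorem mul_pl_le (s e : S) : (⟨s * pl e⟩ : Underlying S) ≤ ⟨s⟩ := by
  rw [← st_pl]; exact mul_st_le s _

theorem st_mul_le (e s : S) : (⟨st e * s⟩ : Underlying S) ≤ ⟨s⟩ :=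
  proj_mul_le (st_st e)

/-- The product of `s` and `t` is the composite of `s t⁺` and `s^* t`. -/
theorem mul_eq_composite (s t : S) : s * pl t * (st s * t) = s * t := by
  rw [mul_assoc s, ← mul_assoc (pl t), ← st_mul_pl, mul_assoc (st s), pl_mul, ← mul_assoc, mul_st]

/-- Both sides equal `s^* t⁺`; this makes the composite of `mul_eq_composite` defined. -/
theorem st_mul_pl_eq (s t : S) : st (s * pl t) = pl (st s * t) := by
  rw [st_mul, ← st_pl t, st_mul_st, st_pl, pl_mul', ← pl_st s, pl_mul_pl]

/-- One inclusion is monotonicity of the product. For the other, `z ≤ s t` gives `z = s (t z^*)`,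
and writing this product as a composite puts its factors below `s` and `t`. -/
theorem setMul_Iic (s t : S) :
    setMul (Set.Iic (⟨s⟩ : Underlying S)) (Set.Iic ⟨t⟩) = Set.Iic ⟨s * t⟩ := by
  ext z; constructor
  · rintro ⟨x, hx, y, hy, h, rfl⟩
    exact natural_mul hx hy
  · intro hz
    obtain ⟨z⟩ := z
    have h1 : z = s * t * st z := hz
    have h3 : s * pl (t * st z) * (st s * (t * st z)) = z := by
      rw [mul_eq_composite, ← mul_assoc, ← h1]
    refine ⟨⟨s * pl (t * st z)⟩, mul_pl_le _ _, ⟨st s * (t * st z)⟩,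
      (st_mul_le _ _).trans (mul_st_le _ _), ?_, congrArg Underlying.mk h3⟩
    exact congrArg Underlying.mk (st_mul_pl_eq _ _)

end ideals

/-! ### The algebra of compact slices associated with a range semigroup -/

section representation

open BiEhresmannSemigroup

variable (S : Type u) [RangeSemigroup S] [Nonempty S] {𝒢 : SliceFamily (Underlying S)}

/-- The compact slices of ultrafilters that contain a principal ideal. -/
def idealAlgebra (h𝒢 : ∀ s, 𝒢.good (Set.Iic s)) : SliceAlgebra (SliceUltrafilter 𝒢) where
  carrier := Set.range fun s : S => hat 𝒢 (Set.Iic ⟨s⟩)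
  nonempty := Set.range_nonempty _
  isSlice := by rintro _ ⟨s, rfl⟩; exact isSlice_hat (injOn_dom_Iic _)
  isCompact := by rintro _ ⟨s, rfl⟩; exact isCompact_hat (h𝒢 _)
  mul_mem := by
    rintro _ ⟨s, rfl⟩ _ ⟨t, rfl⟩
    refine ⟨s * t, ?_⟩
    change hat 𝒢 (Set.Iic _) = _
    rw [← setMul_Iic, hat_setMul (h𝒢 _) (h𝒢 _)]
  dom_mem := by
    rintro _ ⟨s, rfl⟩
    exact ⟨st s, by rw [← hat_setDom (h𝒢 _), setDom_Iic]; rfl⟩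
  ran_mem := by
    rintro _ ⟨s, rfl⟩
    exact ⟨pl s, by rw [← hat_setRan (h𝒢 _), setRan_Iic]; rfl⟩

/-- The representation of a range semigroup by compact slices. -/
def toIdealAlgebra (h𝒢 : ∀ s, 𝒢.good (Set.Iic s)) : BiHom S (idealAlgebra S h𝒢).carrier where
  toFun s := ⟨hat 𝒢 (Set.Iic ⟨s⟩), s, rfl⟩
  map_mul s t := Subtype.ext <| by
    change hat 𝒢 (Set.Iic _) = setMul (hat 𝒢 (Set.Iic _)) (hat 𝒢 (Set.Iic _))
    rw [← setMul_Iic, hat_setMul (h𝒢 _) (h𝒢 _)]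
  map_st s := Subtype.ext <| by
    change hat 𝒢 (Set.Iic (dom (Underlying.mk s))) = setDom (hat 𝒢 (Set.Iic _))
    rw [← hat_setDom (h𝒢 _), setDom_Iic]
  map_pl s := Subtype.ext <| by
    change hat 𝒢 (Set.Iic (ran (Underlying.mk s))) = setRan (hat 𝒢 (Set.Iic _))
    rw [← hat_setRan (h𝒢 _), setRan_Iic]

theorem bijective_toIdealAlgebra (h𝒢 : ∀ s, 𝒢.good (Set.Iic s)) :
    Function.Bijective (toIdealAlgebra S h𝒢).toFun := by
  constructor
  · intro s t h
    have h1 : hat 𝒢 (Set.Iic (⟨s⟩ : Underlying S)) = hat 𝒢 (Set.Iic ⟨t⟩) :=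
      congrArg Subtype.val h
    exact congrArg Underlying.val (Set.Iic_injective (hat_injective (h𝒢 _) (h𝒢 _) h1))
  · rintro ⟨_, s, rfl⟩
    exact ⟨s, rfl⟩

end representation

theorem good_bislices_Iic {S : Type u} [BirestrictionSemigroup S] (s : Underlying S) :
    (SliceFamily.bislices (Underlying S)).good (Set.Iic s) :=
  ⟨injOn_dom_Iic s, injOn_ran_Iic s⟩

/-- The compact bislices of ultrafilters that contain a principal ideal. -/
def idealBisliceAlgebra (S : Type u) [BirestrictionSemigroup S] [Nonempty S] :
    BisliceAlgebra (SliceUltrafilter (.bislices (Underlying S))) where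
  toSliceAlgebra := idealAlgebra S good_bislices_Iic
  isBislice := by
    rintro _ ⟨s, rfl⟩
    exact ⟨isSlice_hat (injOn_dom_Iic _), isCoslice_hat (injOn_ran_Iic _)⟩

/-! ### Isomorphisms -/

/-- The inverse of a bijective morphism. -/
noncomputable def BiHom.inverse {S T : Type u} [BiEhresmannSemigroup S] [BiEhresmannSemigroup T]
    (f : BiHom S T) (hf : Function.Bijective f.toFun) : BiHom T S where
  toFun := (Equiv.ofBijective _ hf).symm
  map_mul x y := hf.1 <| by
    simp only [f.map_mul, Equiv.ofBijective_apply_symm_apply]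
  map_st x := hf.1 <| by
    simp only [f.map_st, Equiv.ofBijective_apply_symm_apply]
  map_pl x := hf.1 <| by
    simp only [f.map_pl, Equiv.ofBijective_apply_symm_apply]

theorem BiHom.comp_inverse {S T : Type u} [BiEhresmannSemigroup S] [BiEhresmannSemigroup T]
    (f : BiHom S T) (hf : Function.Bijective f.toFun) :
    f.comp (f.inverse hf) = BiHom.id S :=
  BiHom.ext (funext fun x => Equiv.ofBijective_symm_apply_apply _ hf x)

theorem BiHom.inverse_comp {S T : Type u} [BiEhresmannSemigroup S] [BiEhresmannSemigroup T]
    (f : BiHom S T) (hf : Function.Bijective f.toFun) :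
    (f.inverse hf).comp f = BiHom.id T :=
  BiHom.ext (funext fun x => Equiv.ofBijective_apply_symm_apply _ hf x)

/-- Bijective morphisms of range semigroups are isomorphisms. -/
noncomputable def RangeSgp.isoOfBijective {S T : RangeSgp.{u}} (f : BiHom S.carrier T.carrier)
    (hf : Function.Bijective f.toFun) : S ≅ T :=
  ⟨f, f.inverse hf, f.comp_inverse hf, f.inverse_comp hf⟩

/-- Bijective morphisms of birestriction semigroups are isomorphisms. -/
noncomputable def BirestrictionSgp.isoOfBijective {S T : BirestrictionSgp.{u}}
    (f : BiHom S.carrier T.carrier) (hf : Function.Bijective f.toFun) : S ≅ T :=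
  ⟨f, f.inverse hf, f.comp_inverse hf, f.inverse_comp hf⟩

/-! ### Morphisms of semigroups and of ordered categories -/

section functors

open BiEhresmannSemigroup

variable {S T : Type u}

section range

variable [RangeSemigroup S] [RangeSemigroup T]

/-- The functor of ordered categories given by a morphism of range semigroups. -/
def BiHom.toRCFunctor (f : BiHom S T) : RCFunctor (Underlying S) (Underlying T) where
  toFun s := ⟨f.toFun s.val⟩
  map_dom s := congrArg Underlying.mk (f.map_st s.val)
  map_ran s := congrArg Underlying.mk (f.map_pl s.val)
  map_comp s t _ := congrArg Underlying.mk (f.map_mul s.val t.val)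
  monotone s t h := by
    have h1 : s.val = t.val * st s.val := h
    change f.toFun s.val = f.toFun t.val * st (f.toFun s.val)
    rw [← f.map_st, ← f.map_mul, ← h1]
  map_meet e he k hk g h := by
    have key : ∀ e ∈ units (Underlying S),
        (⟨f.toFun e.val⟩ : Underlying T) ∈ units (Underlying T) := by
      rintro _ ⟨x, rfl⟩
      exact ⟨⟨f.toFun x.val⟩, congrArg Underlying.mk (f.map_st x.val).symm⟩
    rw [isMeet_underlying_iff he hk] at h
    rw [isMeet_underlying_iff (key e he) (key k hk), h, f.map_mul]
  map_corestriction e he s t _ h := by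
    have key : (⟨f.toFun e.val⟩ : Underlying T) ∈ units (Underlying T) := by
      obtain ⟨x, rfl⟩ := he
      exact ⟨⟨f.toFun x.val⟩, congrArg Underlying.mk (f.map_st x.val).symm⟩
    rw [isCorestriction_iff he] at h
    rw [isCorestriction_iff key, h, f.map_mul]

/-- The product is the composite of `s t⁺` and `s^* t`, and each factor is a restriction or
corestriction to the meet `s^* t⁺`, which `F` preserves. -/
theorem RCFunctor.map_mul (F : RCFunctor (Underlying S) (Underlying T)) (s t : S) :
    F.toFun ⟨s * t⟩ = ⟨(F.toFun ⟨s⟩).val * (F.toFun ⟨t⟩).val⟩ := by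
  set a := (F.toFun ⟨s⟩).val
  set b := (F.toFun ⟨t⟩).val
  have hst : F.toFun ⟨st s⟩ = ⟨st a⟩ := F.map_dom ⟨s⟩
  have hpl : F.toFun ⟨pl t⟩ = ⟨pl b⟩ := F.map_ran ⟨t⟩
  have hus : (⟨st s⟩ : Underlying S) ∈ units (Underlying S) :=
    dom_mem_units (Underlying.mk s)
  have hut : (⟨pl t⟩ : Underlying S) ∈ units (Underlying S) :=
    ran_mem_units (Underlying.mk t)
  have hmeet := F.map_meet _ hus _ hut _ ((isMeet_underlying_iff hus hut).2 rfl)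
  have he : F.toFun ⟨st s * pl t⟩ = ⟨st a * pl b⟩ := by
    rw [isMeet_underlying_iff (F.map_unit hus) (F.map_unit hut), hst, hpl] at hmeet
    exact congrArg Underlying.mk hmeet
  have hue : (⟨st s * pl t⟩ : Underlying S) ∈ units (Underlying S) :=
    ⟨⟨st s * pl t⟩, congrArg Underlying.mk (by rw [← st_pl t, st_mul_st])⟩
  have h1 : F.toFun ⟨s * pl t⟩ = ⟨a * pl b⟩ := by
    -- Both elements lie below the image of `s`, where the domain determines the element.
    refine injOn_dom_Iic (F.toFun ⟨s⟩) (F.monotone _ _ (mul_pl_le s t)) (mul_pl_le a b) ?_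
    have h2 : dom (⟨s * pl t⟩ : Underlying S) = ⟨st s * pl t⟩ :=
      congrArg Underlying.mk (by rw [st_mul, ← st_pl t, st_mul_st])
    rw [← F.map_dom, h2, he]
    exact congrArg Underlying.mk (by rw [st_mul, ← st_pl b, st_mul_st])
  have h2 : F.toFun ⟨st s * t⟩ = ⟨st a * b⟩ := by
    -- The corestriction of `t` to `s^* t⁺` is `s^* t⁺ t = s^* t`.
    have hle : (⟨st s * pl t⟩ : Underlying S) ≤ ran ⟨t⟩ := st_mul_le s (pl t)
    have h3 := F.map_corestriction ⟨st s * pl t⟩ hue ⟨t⟩ ⟨st s * t⟩ hle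
      ((isCorestriction_iff hue).2 (by rw [mul_assoc, pl_mul]))
    rw [isCorestriction_iff (F.map_unit hue), he] at h3
    change (F.toFun ⟨st s * t⟩).val = st a * pl b * b at h3
    rw [mul_assoc, pl_mul] at h3
    exact congrArg Underlying.mk h3
  have hc : dom (⟨s * pl t⟩ : Underlying S) = ran ⟨st s * t⟩ :=
    congrArg Underlying.mk (st_mul_pl_eq s t)
  have hc' : dom (⟨a * pl b⟩ : Underlying T) = ran ⟨st a * b⟩ :=
    congrArg Underlying.mk (st_mul_pl_eq a b)
  have h3 : SmallCat.comp (⟨s * pl t⟩ : Underlying S) ⟨st s * t⟩ hc = ⟨s * t⟩ :=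
    congrArg Underlying.mk (mul_eq_composite s t)
  rw [← h3, F.map_comp, comp_congr h1 h2 _ hc']
  exact congrArg Underlying.mk (mul_eq_composite a b)

/-- The morphism of range semigroups given by a functor of ordered categories. -/
def RCFunctor.toBiHom (F : RCFunctor (Underlying S) (Underlying T)) : BiHom S T where
  toFun s := (F.toFun ⟨s⟩).val
  map_mul s t := congrArg Underlying.val (F.map_mul s t)
  map_st s := congrArg Underlying.val (F.map_dom ⟨s⟩)
  map_pl s := congrArg Underlying.val (F.map_ran ⟨s⟩)

end range

/-- Inductive functors preserve corestrictions. -/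
def IndFunctor.toRCFunctor [BirestrictionSemigroup S] [BirestrictionSemigroup T]
    (F : IndFunctor (Underlying S) (Underlying T)) : RCFunctor (Underlying S) (Underlying T) where
  toIndFunctor := F
  map_corestriction e he s t hs h := by
    obtain ⟨t', ht', hr⟩ := OrderedCatRC.corestriction e he s hs
    obtain rfl := h.unique ht'
    have hs' : F.toFun e ≤ ran (F.toFun s) := by
      rw [← F.map_ran]; exact F.monotone _ _ hs
    obtain ⟨w, hw, hwr⟩ := OrderedCatRC.corestriction (F.toFun e) (F.map_unit he) (F.toFun s) hs'
    -- Both elements lie below `F s` and have range `F e`.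
    have : F.toFun t = w :=
      injOn_ran_Iic (F.toFun s) (F.monotone _ _ h.1.1) hw.1.1 (by rw [← F.map_ran, hr, hwr])
    rw [this]; exact hw

end functors

/-- The functor `𝒰` from range semigroups to ordered categories. -/
def RangeSgp.toOrdCatRC : RangeSgp.{u} ⥤ OrdCatRC.{u} where
  obj S := ⟨Underlying S.carrier⟩
  map f := BiHom.toRCFunctor f

instance : RangeSgp.toOrdCatRC.{u}.Faithful where
  map_injective {S T _ _} h := BiHom.ext <| funext fun s =>
    congrArg (fun F : RCFunctor (Underlying S.carrier) (Underlying T.carrier) =>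
      (F.toFun ⟨s⟩).val) h

instance : RangeSgp.toOrdCatRC.{u}.Full where
  map_surjective F := ⟨RCFunctor.toBiHom F, rfl⟩

/-- The functor `𝒰` from birestriction semigroups to inductive categories. -/
def BirestrictionSgp.toIndCat : BirestrictionSgp.{u} ⥤ IndCat.{u} where
  obj S := ⟨Underlying S.carrier⟩
  map f := (BiHom.toRCFunctor f).toIndFunctor

instance : BirestrictionSgp.toIndCat.{u}.Faithful where
  map_injective {S T _ _} h := BiHom.ext <| funext fun s =>
    congrArg (fun F : IndFunctor (Underlying S.carrier) (Underlying T.carrier) =>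
      (F.toFun ⟨s⟩).val) h

instance : BirestrictionSgp.toIndCat.{u}.Full where
  map_surjective F := ⟨RCFunctor.toBiHom (IndFunctor.toRCFunctor F), rfl⟩

/-! ### Inverse semigroups -/

namespace InverseSemigroup

section

variable {S : Type u} [InverseSemigroup S]

/-- The inverse of an element of an inverse semigroup. -/
noncomputable def inv (a : S) : S := (existsUnique_inverse a).choose

theorem mul_inv_mul (a : S) : a * inv a * a = a := (existsUnique_inverse a).choose_spec.1.1

theorem inv_mul_inv (a : S) : inv a * a * inv a = inv a :=
  (existsUnique_inverse a).choose_spec.1.2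

theorem eq_inv {a b : S} (h : a * b * a = a) (k : b * a * b = b) : b = inv a :=
  (existsUnique_inverse a).unique ⟨h, k⟩ ⟨mul_inv_mul a, inv_mul_inv a⟩

theorem inv_eq_self {e : S} (he : e * e = e) : inv e = e :=
  (eq_inv (by rw [he, he]) (by rw [he, he])).symm

/-- If `x` is the inverse of `e f`, then so is `f x e`, whence `x = f x e`. This makes `x`
idempotent, hence equal to its own inverse `e f`. -/
theorem mul_idem_of_idem {e f : S} (he : e * e = e) (hf : f * f = f) :
    e * f * (e * f) = e * f := by
  set x := inv (e * f)
  have h1 : e * f * x * (e * f) = e * f := mul_inv_mul _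
  have h2 : x * (e * f) * x = x := inv_mul_inv _
  have h3 : f * x * e = x := by
    refine eq_inv ?_ ?_
    · calc e * f * (f * x * e) * (e * f) = e * (f * f) * x * (e * e) * f := by
            simp only [mul_assoc]
        _ = e * f * x * (e * f) := by rw [he, hf]; simp only [mul_assoc]
        _ = e * f := h1
    · calc f * x * e * (e * f) * (f * x * e) = f * (x * ((e * e) * (f * f)) * x) * e := by
            simp only [mul_assoc]
        _ = f * x * e := by rw [he, hf, h2]
  have h4 : x * x = x := by
    calc x * x = f * x * e * (f * x * e) := by rw [h3]
      _ = f * (x * (e * f) * x) * e := by simp only [mul_assoc]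
      _ = x := by rw [h2, h3]
  have h5 : e * f = inv x := eq_inv h2 h1
  rw [inv_eq_self h4] at h5
  rw [h5, h4]

/-- The product `f e` is an inverse of the idempotent `e f`, which is its own inverse. -/
theorem mul_comm_of_idem {e f : S} (he : e * e = e) (hf : f * f = f) : e * f = f * e := by
  have h1 := mul_idem_of_idem he hf
  have h2 := mul_idem_of_idem hf he
  have h3 : f * e = inv (e * f) := by
    refine eq_inv ?_ ?_
    · calc e * f * (f * e) * (e * f) = e * (f * f) * (e * e) * f := by simp only [mul_assoc]
        _ = e * f := by rw [he, hf, mul_assoc, h1]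
    · calc f * e * (e * f) * (f * e) = f * (e * e) * (f * f) * e := by simp only [mul_assoc]
        _ = f * e := by rw [he, hf, mul_assoc, h2]
  rw [h3, inv_eq_self h1]

theorem inv_mul_idem (a : S) : inv a * a * (inv a * a) = inv a * a := by
  rw [← mul_assoc, inv_mul_inv]

theorem mul_inv_idem (a : S) : a * inv a * (a * inv a) = a * inv a := by
  rw [← mul_assoc, mul_inv_mul]

theorem inv_mul (a b : S) : inv (a * b) = inv b * inv a := by
  have hc := mul_comm_of_idem (inv_mul_idem a) (mul_inv_idem b)
  refine (eq_inv ?_ ?_).symm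
  · calc a * b * (inv b * inv a) * (a * b) = a * (b * inv b * (inv a * a)) * b := by
          simp only [mul_assoc]
      _ = a * inv a * a * (b * inv b * b) := by rw [← hc]; simp only [mul_assoc]
      _ = a * b := by rw [mul_inv_mul, mul_inv_mul]
  · calc inv b * inv a * (a * b) * (inv b * inv a)
        = inv b * (inv a * a * (b * inv b)) * inv a := by simp only [mul_assoc]
      _ = inv b * b * inv b * (inv a * a * inv a) := by rw [hc]; simp only [mul_assoc]
      _ = inv b * inv a := by rw [inv_mul_inv, inv_mul_inv]

theorem inv_mul_self_of_idem {e : S} (he : e * e = e) : inv e * e = e := by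
  rw [inv_eq_self he, he]

theorem mul_inv_self_of_idem {e : S} (he : e * e = e) : e * inv e = e := by
  rw [inv_eq_self he, he]

end

/-- Inverse semigroups are birestriction semigroups with `x^* = x⁻¹ x` and `x^+ = x x⁻¹`. -/
noncomputable instance toBirestrictionSemigroup {S : Type u} [InverseSemigroup S] :
    BirestrictionSemigroup S where
  st x := inv x * x
  pl x := x * inv x
  mul_st x := by rw [← mul_assoc, mul_inv_mul]
  st_comm x y := mul_comm_of_idem (inv_mul_idem x) (inv_mul_idem y)
  st_mul_st x y := inv_mul_self_of_idem (mul_idem_of_idem (inv_mul_idem x) (inv_mul_idem y))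
  st_mul x y := by
    rw [inv_mul, inv_mul (inv x * x), inv_eq_self (inv_mul_idem x)]
    calc inv y * inv x * (x * y) = inv y * (inv x * x) * y := by simp only [mul_assoc]
      _ = inv y * (inv x * x * (inv x * x)) * y := by rw [inv_mul_idem]
      _ = _ := by simp only [mul_assoc]
  pl_mul x := mul_inv_mul x
  pl_comm x y := mul_comm_of_idem (mul_inv_idem x) (mul_inv_idem y)
  pl_mul_pl x y := mul_inv_self_of_idem (mul_idem_of_idem (mul_inv_idem x) (mul_inv_idem y))
  pl_mul' x y := by
    rw [inv_mul, inv_mul x (y * inv y), inv_eq_self (mul_inv_idem y)]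
    calc x * y * (inv y * inv x) = x * (y * inv y) * inv x := by simp only [mul_assoc]
      _ = x * (y * inv y * (y * inv y)) * inv x := by rw [mul_inv_idem]
      _ = _ := by simp only [mul_assoc]
  st_pl x := inv_mul_self_of_idem (mul_inv_idem x)
  pl_st x := mul_inv_self_of_idem (inv_mul_idem x)
  restr x y := by
    rw [inv_mul]
    calc inv x * x * y = inv x * x * (y * inv y) * y := by
          rw [mul_assoc _ (y * inv y), mul_inv_mul]
      _ = y * inv y * (inv x * x) * y := by
          rw [mul_comm_of_idem (inv_mul_idem x) (mul_inv_idem y)]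
      _ = _ := by simp only [mul_assoc]
  corestr x y := by
    rw [inv_mul]
    calc x * (y * inv y) = x * (inv x * x * (y * inv y)) := by
          rw [← mul_assoc x (inv x * x), ← mul_assoc x (inv x), mul_inv_mul]
      _ = x * (y * inv y * (inv x * x)) := by
          rw [mul_comm_of_idem (inv_mul_idem x) (mul_inv_idem y)]
      _ = _ := by simp only [mul_assoc]

theorem map_inv {S T : Type u} [InverseSemigroup S] [InverseSemigroup T] (f : S →ₙ* T) (a : S) :
    f (inv a) = inv (f a) :=
  eq_inv (by rw [← map_mul, ← map_mul, mul_inv_mul]) (by rw [← map_mul, ← map_mul, inv_mul_inv])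

/-- Homomorphisms of inverse semigroups preserve the derived operations. -/
noncomputable def toBiHom {S T : Type u} [InverseSemigroup S] [InverseSemigroup T]
    (f : S →ₙ* T) : BiHom S T where
  toFun := f
  map_mul := map_mul f
  map_st x := by
    change f (inv x * x) = inv (f x) * f x
    rw [map_mul, map_inv]
  map_pl x := by
    change f (x * inv x) = f x * inv (f x)
    rw [map_mul, map_inv]

theorem isInverseArrow_inv {S : Type u} [InverseSemigroup S] (x : S) :
    IsInverseArrow (⟨x⟩ : Underlying S) ⟨inv x⟩ := by
  have h : inv (inv x) = x := (eq_inv (inv_mul_inv x) (mul_inv_mul x)).symm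
  refine ⟨congrArg Underlying.mk ?_, congrArg Underlying.mk ?_, rfl, rfl⟩
  · change inv x * x = inv x * inv (inv x)
    rw [h]
  · change inv (inv x) * inv x = x * inv x
    rw [h]

end InverseSemigroup

/-! ### Birestriction semigroups whose underlying category is a groupoid -/

section groupoid

open BiEhresmannSemigroup

variable {T : Type u} [BirestrictionSemigroup T]

theorem IsInverseArrow.mul_eq {x y : T} (h : IsInverseArrow (⟨x⟩ : Underlying T) ⟨y⟩) :
    x * y = pl x ∧ y * x = st x :=
  ⟨congrArg Underlying.val h.2.2.1, congrArg Underlying.val h.2.2.2⟩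

theorem IsInverseArrow.mul_mul {x y : T} (h : IsInverseArrow (⟨x⟩ : Underlying T) ⟨y⟩) :
    x * y * x = x ∧ y * x * y = y := by
  have h1 := h.mul_eq.1
  have h2 := h.symm.mul_eq.1
  rw [h1, h2, pl_mul, pl_mul]
  exact ⟨rfl, rfl⟩

/-- If `f` is the groupoid inverse of `e`, then `e^* = f e`, so `e^* e = f e e = e^*`. On the other
hand `e^* e = e (e e)^* = e`. -/
theorem st_eq_self_of_idem (hT : ∀ x : Underlying T, ∃ y, IsInverseArrow x y) {e : T}
    (he : e * e = e) : st e = e := by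
  obtain ⟨⟨f⟩, hf⟩ := hT ⟨e⟩
  have h1 := hf.mul_eq.2
  have h2 : st e * e = st e := by rw [← h1, mul_assoc, he]
  rw [← h2, RangeSemigroup.restr, he, mul_st]

/-- A birestriction semigroup whose underlying category is a groupoid is an inverse semigroup. -/
abbrev inverseSemigroupOfGroupoid (hT : ∀ x : Underlying T, ∃ y, IsInverseArrow x y) :
    InverseSemigroup T where
  existsUnique_inverse x := by
    have hcomm : ∀ e f : T, e * e = e → f * f = f → e * f = f * e := fun e f he hf => by
      rw [← st_eq_self_of_idem hT he, ← st_eq_self_of_idem hT hf, st_comm]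
    obtain ⟨⟨y⟩, hy⟩ := hT ⟨x⟩
    obtain ⟨y1, y2⟩ := hy.mul_mul
    refine ⟨y, ⟨y1, y2⟩, ?_⟩
    rintro z ⟨z1, z2⟩
    -- Idempotents are projections, so the idempotents `x y` and `x z` commute and absorb each
    -- other.
    have h1 : x * y = x * z := by
      calc x * y = x * z * (x * y) := by rw [← mul_assoc, z1]
        _ = x * y * (x * z) :=
          hcomm _ _ (by rw [← mul_assoc, z1]) (by rw [← mul_assoc, y1])
        _ = x * z := by rw [← mul_assoc, y1]
    have h2 : y * x = z * x := by
      calc y * x = y * x * (z * x) := by rw [mul_assoc, ← mul_assoc x, z1]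
        _ = z * x * (y * x) :=
          hcomm _ _ (by rw [← mul_assoc, y2]) (by rw [← mul_assoc, z2])
        _ = z * x := by rw [mul_assoc, ← mul_assoc x, y1]
    rw [← y2, h2, mul_assoc, h1, ← mul_assoc, z2]

theorem inv_eq_of_isInverseArrow (hT : ∀ x : Underlying T, ∃ y, IsInverseArrow x y) {x y : T}
    (h : IsInverseArrow (⟨x⟩ : Underlying T) ⟨y⟩) :
    @InverseSemigroup.inv T (inverseSemigroupOfGroupoid hT) x = y :=
  (@InverseSemigroup.eq_inv T (inverseSemigroupOfGroupoid hT) x y h.mul_mul.1 h.mul_mul.2).symm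

end groupoid

/-- The functor from inverse semigroups to birestriction semigroups. -/
noncomputable def InverseSgp.toBirestrictionSgp : InverseSgp.{u} ⥤ BirestrictionSgp.{u} where
  obj S := ⟨S.carrier⟩
  map f := InverseSemigroup.toBiHom f

instance : InverseSgp.toBirestrictionSgp.{u}.Faithful where
  map_injective {S T _ _} h := MulHom.ext fun s =>
    congrArg (fun F : BiHom S.carrier T.carrier => F.toFun s) h

instance : InverseSgp.toBirestrictionSgp.{u}.Full where
  map_surjective {S T} F :=
    ⟨MulHom.mk (BiHom.toFun (S := S.carrier) (T := T.carrier) F)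
      (BiHom.map_mul (S := S.carrier) (T := T.carrier) F), rfl⟩

theorem InverseSgp.isInductiveGroupoid (S : InverseSgp.{u}) :
    ESN.isInductiveGroupoid (BirestrictionSgp.toIndCat.obj (toBirestrictionSgp.obj S)) :=
  ⟨fun x => ⟨_, InverseSemigroup.isInverseArrow_inv (S := S.carrier) x.val⟩,
    fun _ _ _ _ hx hy h => IsInverseArrow.le_of_le hx hy h⟩

/-- The functor from inverse semigroups to inductive groupoids. -/
noncomputable def InverseSgp.toIndGpd : InverseSgp.{u} ⥤ IndGpd.{u} :=
  ESN.isInductiveGroupoid.lift (toBirestrictionSgp ⋙ BirestrictionSgp.toIndCat)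
    InverseSgp.isInductiveGroupoid

instance : InverseSgp.toIndGpd.{u}.Faithful := by
  unfold InverseSgp.toIndGpd; infer_instance

instance : InverseSgp.toIndGpd.{u}.Full := by
  unfold InverseSgp.toIndGpd; infer_instance

/-- The groupoid inverse is the semigroup inverse, so the operations `x⁻¹ x` and `x x⁻¹` agree with
the given ones and the identity map is an isomorphism. -/
theorem BirestrictionSgp.exists_iso_of_groupoid (T : BirestrictionSgp.{u})
    (hT : ∀ x : Underlying T.carrier, ∃ y, IsInverseArrow x y) :
    ∃ S : InverseSgp.{u}, Nonempty (InverseSgp.toBirestrictionSgp.obj S ≅ T) := by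
  let S : InverseSgp.{u} := @InverseSgp.mk T.carrier _ (inverseSemigroupOfGroupoid hT)
  let f : BiHom (InverseSgp.toBirestrictionSgp.obj S).carrier T.carrier :=
    { toFun := fun x => x
      map_mul := fun _ _ => rfl
      map_st := fun x => by
        obtain ⟨⟨y⟩, hy⟩ := hT ⟨x⟩
        exact (congrArg (· * x) (inv_eq_of_isInverseArrow hT hy)).trans hy.mul_eq.2
      map_pl := fun x => by
        obtain ⟨⟨y⟩, hy⟩ := hT ⟨x⟩
        exact (congrArg (x * ·) (inv_eq_of_isInverseArrow hT hy)).trans hy.mul_eq.1 }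
  exact ⟨S, ⟨BirestrictionSgp.isoOfBijective f Function.bijective_id⟩⟩

/-- The compact bislices of ultrafilters that contain a principal ideal of an inverse semigroup. -/
noncomputable def idealInverseAlgebra (S : Type u) [InverseSemigroup S] [Nonempty S] :
    InverseBisliceAlgebra (SliceUltrafilter (.bislices (Underlying S))) where
  carrier := (idealBisliceAlgebra S).carrier
  nonempty := (idealBisliceAlgebra S).nonempty
  isBislice := (idealBisliceAlgebra S).isBislice
  isCompact := (idealBisliceAlgebra S).isCompact
  mul_mem := (idealBisliceAlgebra S).mul_mem
  inv_mem := by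
    have hC : ∀ x : Underlying S, ∃ y, IsInverseArrow x y :=
      fun x => ⟨_, InverseSemigroup.isInverseArrow_inv x.val⟩
    rintro _ ⟨s, rfl⟩
    refine ⟨InverseSemigroup.inv s, ?_⟩
    change hat _ (Set.Iic _) = setInv (hat _ (Set.Iic _))
    rw [setInv_hat hC]
    congr 1
    -- Inversion preserves the order in both directions, so it carries the ideal of `s` onto the
    -- ideal of `s⁻¹`.
    have hs := InverseSemigroup.isInverseArrow_inv s
    ext z; constructor
    · intro hz
      obtain ⟨x, hx⟩ := hC z
      exact ⟨x, hx.le_of_le hs.symm hz, hx.symm⟩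
    · rintro ⟨x, hx, hxz⟩
      exact hxz.le_of_le hs hx

/-! ### The equivalences -/

/-- A fully faithful functor is an equivalence onto its essential image. By `k`, every object of
that image is isomorphic to one satisfying `P`, so the inclusion of the latter is an equivalence as
well. -/
theorem nonempty_equivalence_fullSubcategory {A : Type*} {B : Type*} [Category* A] [Category* B]
    (F : A ⥤ B) [F.Full] [F.Faithful] (P : ObjectProperty B) (h : P ≤ F.essImage)
    (k : ∀ a, ∃ X, P X ∧ Nonempty (F.obj a ≅ X)) : Nonempty (A ≌ P.FullSubcategory) := by
  let G : P.FullSubcategory ⥤ F.essImage.FullSubcategory := ObjectProperty.ιOfLE h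
  have : G.EssSurj := ⟨fun Y => by
    obtain ⟨a, ⟨e⟩⟩ := Y.2
    obtain ⟨X, hX, ⟨e'⟩⟩ := k a
    exact ⟨⟨X, hX⟩, ⟨F.essImage.fullyFaithfulι.preimageIso (e'.symm ≪≫ e)⟩⟩⟩
  have : G.IsEquivalence := { }
  exact ⟨F.toEssImage.asEquivalence.trans G.asEquivalence.symm⟩

end ESN

theorem mainTheorem10 :
    Nonempty (ESN.RangeSgp.{u} ≌ ESN.ofCompactSlices.{u}.FullSubcategory) ∧
    Nonempty (ESN.BirestrictionSgp.{u} ≌ ESN.ofCompactBislices.{u}.FullSubcategory) ∧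
    Nonempty (ESN.InverseSgp.{u} ≌ ESN.ofCompactBislicesGroupoid.{u}.FullSubcategory) := by
  open ESN in
  refine ⟨nonempty_equivalence_fullSubcategory RangeSgp.toOrdCatRC _ ?_ ?_,
    nonempty_equivalence_fullSubcategory BirestrictionSgp.toIndCat _ ?_ ?_,
    nonempty_equivalence_fullSubcategory InverseSgp.toIndGpd _ ?_ ?_⟩
  · rintro _ ⟨C, _, _, -, A, rfl⟩
    have := A.nonempty.to_subtype
    exact RangeSgp.toOrdCatRC.obj_mem_essImage ⟨A.carrier⟩
  · intro S
    have hS : ∀ s, (SliceFamily.slices (Underlying S.carrier)).good (Set.Iic s) := injOn_dom_Iic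
    have := (idealAlgebra S.carrier hS).nonempty.to_subtype
    exact ⟨_, ⟨_, _, _, isStronglyAmple_sliceUltrafilter _, idealAlgebra S.carrier hS, rfl⟩,
      ⟨RangeSgp.toOrdCatRC.mapIso (RangeSgp.isoOfBijective
        (T := ⟨(idealAlgebra S.carrier hS).carrier⟩) _ (bijective_toIdealAlgebra S.carrier hS))⟩⟩
  · rintro _ ⟨C, _, _, -, A, rfl⟩
    have := A.nonempty.to_subtype
    exact BirestrictionSgp.toIndCat.obj_mem_essImage ⟨A.carrier⟩
  · intro S
    have := (idealBisliceAlgebra S.carrier).nonempty.to_subtype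
    exact ⟨_, ⟨_, _, _, isBiample_sliceUltrafilter _, idealBisliceAlgebra S.carrier, rfl⟩,
      ⟨BirestrictionSgp.toIndCat.mapIso (BirestrictionSgp.isoOfBijective
        (T := ⟨(idealBisliceAlgebra S.carrier).carrier⟩) _
        (bijective_toIdealAlgebra S.carrier good_bislices_Iic))⟩⟩
  · rintro _ ⟨C, _, _, hC, A, rfl⟩
    have := (A.toBisliceAlgebra hC.exists_inverse).nonempty.to_subtype
    -- Inductive groupoids are full in inductive categories, so an isomorphism of birestriction
    -- semigroups suffices.
    obtain ⟨S, ⟨e⟩⟩ := BirestrictionSgp.exists_iso_of_groupoid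
      ⟨(A.toBisliceAlgebra hC.exists_inverse).carrier⟩
      (A.isInductiveGroupoid hC.exists_inverse).1
    exact ⟨S, ⟨isInductiveGroupoid.fullyFaithfulι.preimageIso
      (BirestrictionSgp.toIndCat.mapIso e)⟩⟩
  · intro S
    have hS : ∀ x : Underlying S.carrier, ∃ y, IsInverseArrow x y :=
      fun x => ⟨_, InverseSemigroup.isInverseArrow_inv x.val⟩
    have := (idealBisliceAlgebra S.carrier).nonempty.to_subtype
    exact ⟨_, ⟨_, _, _, isAmpleGroupoid_sliceUltrafilter hS, idealInverseAlgebra S.carrier, rfl⟩,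
      ⟨isInductiveGroupoid.fullyFaithfulι.preimageIso
        (BirestrictionSgp.toIndCat.mapIso (BirestrictionSgp.isoOfBijective
          (S := ⟨S.carrier⟩) (T := ⟨(idealBisliceAlgebra S.carrier).carrier⟩) _
          (bijective_toIdealAlgebra S.carrier good_bislices_Iic)))⟩⟩
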